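/- Let $\chi(\xi,\lambda)=\chi_R(\xi,\lambda)+i\chi_I(\xi,\lambda)$, $\xi,\lambda\in\mathbb R$, be a complex-valued function such that: (a) $\chi$ and $\partial_\xi\chi$ exist and are continuous on $\mathbb R^2$; $|\partial_\xi\chi_R|\le\frac14\tan\frac{\pi}{8}$ and $|\partial_\xi\chi_I|\le\frac14\tan\frac{\pi}{8}$ everywhere; and there is $C>0$ with $|\chi(\xi,\lambda)|\le \frac{C}{1+|\lambda|}$ for all $\xi,\lambda$. (b) For each $\lambda\in\mathbb R$, $\chi(\cdot,\lambda)$ extends to a continuous function on the closed lower half-plane $\{\operatorname{Im}\xi\le0\}$ that is holomorphic in $\{\operatorname{Im}\xi<0\}$ and tends to $0$ as $|\xi|\to\infty$. (c) $\partial_\lambda\chi$, $\partial_\xi\partial_\lambda\chi$ and $\partial_\xi^2\chi$ exist and are continuous on $\mathbb R^2$. (d) There is $C>0$ such that for all $\xi,\lambda\in\mathbb R$: $|\chi|\le\frac{C}{1+|\lambda|^2}$, $|\chi|\le\frac{C}{1+|\xi|}$, $|\partial_\xi\chi|\le\frac{C}{1+|\lambda|^3}$, $|\partial_\xi\chi|\le\frac{C}{1+|\xi|^2}$,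 $|\partial_\xi^2\chi|\le C$, $|\partial_\lambda\chi|\le\frac{C}{1+|\lambda|}$. (e) For every $D>0$ there is $C(D)>0$ such that for all $\xi\in\mathbb R$ and all $|\lambda|\le4D$: $|\partial_\lambda\chi|\le\frac{C(D)}{1+|\xi|}$, $|\partial_\xi\chi|\le\frac{C(D)}{1+|\xi|^2}$, $|\partial_\lambda\partial_\xi\chi|\le\frac{C(D)}{1+|\xi|^2}$, $|\partial_\xi^2\chi|\le\frac{C(D)}{1+|\xi|^3}$. Then for all $x,y,t\in\mathbb R$ with $t\ge0$ the nonlinear integral equation (for almost every $\lambda\in\mathbb R$, with principal value integral) $$\psi(x,y,t,\lambda)+\chi_R(\psi(x,y,t,\lambda),\lambda)=x-\lambda y-\lambda^2t-\frac1\pi\,\mathrm{p.v.}\!\!\int_{\mathbb R}\frac{\chi_I(\psi(x,y,t,\zeta),\zeta)}{\zeta-\lambda}\,d\zeta$$ has a solution of the form $\psi=x-\lambda y-\lambda^2t+\omega(x,y,t,\lambda)$ with real-valued $\omega(x,y,t,\cdot)\in L^2(\mathbb R,d\lambda)$, unique up to equality for almost every $\lambda$; it has a (unique) representative continuous in $\lambda$;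 and for this representative and every fixed $\tau,t,\lambda_0\in\mathbb R$ with $t\ge0$, $$\omega(\tau+\lambda_0y,\,y,\,t,\,\lambda_0)\to0\qquad\text{as } y\to-\infty .$$ -/

import Mathlib

open Filter Topology MeasureTheory

namespace PavlovIST

/-- Partial derivative with respect to the first variable `ξ`. -/
noncomputable def dXi (χ : ℝ → ℝ → ℂ) (ξ lam : ℝ) : ℂ := deriv (fun s : ℝ => χ s lam) ξ

/-- Partial derivative with respect to the second variable (the spectral parameter). -/
noncomputable def dLam (χ : ℝ → ℝ → ℂ) (ξ lam : ℝ) : ℂ := deriv (fun s : ℝ => χ ξ s) lam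

/-- The principal value integral `p.v. ∫ f(ζ) / (ζ - a) dζ` exists and is equal to `v`. -/
def HasPVIntegral (f : ℝ → ℝ) (a v : ℝ) : Prop :=
  (∀ ε : ℝ, 0 < ε → IntegrableOn (fun ζ : ℝ => f ζ / (ζ - a)) {ζ : ℝ | ε < |ζ - a|}) ∧
  Tendsto (fun ε : ℝ => ∫ ζ in {ζ : ℝ | ε < |ζ - a|}, f ζ / (ζ - a)) (𝓝[>] 0) (𝓝 v)

/-- `ψ(x,y,t,λ) = x - λ y - λ² t + ω(λ)`. -/
def psi (x y t : ℝ) (ω : ℝ → ℝ) (lam : ℝ) : ℝ := x - lam * y - lam ^ 2 * t + ω lam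

/-- `ω ∈ L²(dλ)`, and `ψ = x - λ y - λ² t + ω` solves the nonlinear integral equation
`ψ(λ) + χ_R(ψ(λ),λ) = x - λ y - λ² t - (1/π) p.v. ∫ χ_I(ψ(ζ),ζ) / (ζ - λ) dζ`
for almost every real `λ`. -/
def IsInverseSolution (χ : ℝ → ℝ → ℂ) (x y t : ℝ) (ω : ℝ → ℝ) : Prop :=
  MemLp ω 2 volume ∧
  ∀ᵐ lam : ℝ, ∃ v : ℝ,
    HasPVIntegral (fun ζ : ℝ => (χ (psi x y t ω ζ) ζ).im) lam v ∧
    psi x y t ω lam + (χ (psi x y t ω lam) lam).re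
      = x - lam * y - lam ^ 2 * t - 1 / Real.pi * v

/-- The constraints under which the nonlinear integral equation is uniquely solvable. -/
structure SolvabilityConditions (χ : ℝ → ℝ → ℂ) : Prop where
  continuous : Continuous (fun p : ℝ × ℝ => χ p.1 p.2)
  differentiable_xi : ∀ lam : ℝ, Differentiable ℝ (fun ξ : ℝ => χ ξ lam)
  continuous_dXi : Continuous (fun p : ℝ × ℝ => dXi χ p.1 p.2)
  dXi_re_le : ∀ ξ lam : ℝ, |(dXi χ ξ lam).re| ≤ 1 / 4 * Real.tan (Real.pi / 8)
  dXi_im_le : ∀ ξ lam : ℝ, |(dXi χ ξ lam).im| ≤ 1 / 4 * Real.tan (Real.pi / 8)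
  decay : ∃ C : ℝ, 0 < C ∧ ∀ ξ lam : ℝ, ‖χ ξ lam‖ ≤ C / (1 + |lam|)

/-- `f : ℝ → ℂ` is the boundary value of a function holomorphic in the open lower half-plane,
continuous up to the real axis and vanishing at infinity. -/
def IsLowerHalfPlaneBoundaryValue (f : ℝ → ℂ) : Prop :=
  ∃ F : ℂ → ℂ,
    ContinuousOn F {z : ℂ | z.im ≤ 0} ∧
    DifferentiableOn ℂ F {z : ℂ | z.im < 0} ∧
    Tendsto F (cocompact ℂ ⊓ 𝓟 {z : ℂ | z.im ≤ 0}) (𝓝 0) ∧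
    ∀ ξ : ℝ, F (ξ : ℂ) = f ξ

/-- The additional analyticity, smoothness and decay constraints on the spectral data. -/
structure JostConditions (χ : ℝ → ℝ → ℂ) : Prop where
  holomorphic : ∀ lam : ℝ, IsLowerHalfPlaneBoundaryValue (fun ξ : ℝ => χ ξ lam)
  differentiable_lam : ∀ ξ : ℝ, Differentiable ℝ (fun lam : ℝ => χ ξ lam)
  continuous_dLam : Continuous (fun p : ℝ × ℝ => dLam χ p.1 p.2)
  differentiable_dLam_xi : ∀ lam : ℝ, Differentiable ℝ (fun ξ : ℝ => dLam χ ξ lam)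
  continuous_dXi_dLam : Continuous (fun p : ℝ × ℝ => dXi (dLam χ) p.1 p.2)
  differentiable_dXi_xi : ∀ lam : ℝ, Differentiable ℝ (fun ξ : ℝ => dXi χ ξ lam)
  continuous_dXi_dXi : Continuous (fun p : ℝ × ℝ => dXi (dXi χ) p.1 p.2)
  global_bounds : ∃ C : ℝ, 0 < C ∧ ∀ ξ lam : ℝ,
    ‖χ ξ lam‖ ≤ C / (1 + |lam| ^ 2) ∧
    ‖χ ξ lam‖ ≤ C / (1 + |ξ|) ∧
    ‖dXi χ ξ lam‖ ≤ C / (1 + |lam| ^ 3) ∧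
    ‖dXi χ ξ lam‖ ≤ C / (1 + |ξ| ^ 2) ∧
    ‖dXi (dXi χ) ξ lam‖ ≤ C ∧
    ‖dLam χ ξ lam‖ ≤ C / (1 + |lam|)
  local_bounds : ∀ D : ℝ, 0 < D → ∃ C : ℝ, 0 < C ∧ ∀ ξ lam : ℝ, |lam| ≤ 4 * D →
    ‖dLam χ ξ lam‖ ≤ C / (1 + |ξ|) ∧
    ‖dXi χ ξ lam‖ ≤ C / (1 + |ξ| ^ 2) ∧
    ‖dXi (dLam χ) ξ lam‖ ≤ C / (1 + |ξ| ^ 2) ∧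
    ‖dXi (dXi χ) ξ lam‖ ≤ C / (1 + |ξ| ^ 3)

end PavlovIST

namespace PavlovIST

/-! In terms of `ω` the equation reads `ω = -R - (1/π) p.v.∫ I(ζ)/(ζ - λ) dζ`, where `R + iI` is `χ`
evaluated at `(p(λ) + ω(λ), λ)` and `p(λ) = x - λy - λ²t`. The principal value integral has norm at
most 2π on L² (`memLp_and_eLpNorm_le_of_hasPVIntegral`), so two instances of this relation differ in
L² by at most 3 times a common majorant of the differences of `R` and of `I`
(`IsRieszSum.eLpNorm_sub_le`). Since `tan(π/8) ≤ 1`, `R` and `I` are 1/4-Lipschitz in `ω`, and the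
equation is a contraction with factor 3/4. This gives uniqueness, and turns every estimate `a ≤
3(a/4 + b)` into `a ≤ 12b`.

For existence the principal value must be known to converge at each step. The iteration therefore
runs in the closed set of `ω` with `‖ω(· + h) - ω‖₂ ≤ M|h|`. Such functions have a continuous,
1/2-Hölder representative (`exists_continuous_ae_eq_of_isL2Lipschitz`, `IsL2Lipschitz.holder`), for
which the principal value exists everywhere, and a suitable `M` is preserved by the step.

For the limit put `y = -Y` and `τ' = τ - λ₀²t`. The phase equals `τ' + (μ - λ₀)(Y - t(μ + λ₀))`, so
near `λ₀` the data are close to the profile `χ(τ' + Y(μ - λ₀), λ₀)`. As a function of `μ` the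
profile is a boundary value from the lower half-plane, and by the Plemelj relation its contribution
`-R - (1/π) p.v.∫ I/(ζ - λ)` vanishes identically (`isRieszSum_zero_of_boundaryValue`). Hence `‖ω‖₂`
is at most 12 times the norm of the defect, which is `o(Y^(-1/2))`, while the Lipschitz constant of
`ω` is `O(Y^(1/2))` up to a factor `1 + (sup|ω|)²`. The interpolation inequality `|ω| ≤ ‖ω‖₂/√r +
2M√r` with `r = o(1/Y)` then forces `sup|ω| → 0` (`exists_abs_le_sqrt_mul`). -/

theorem one_div_one_add_abs_sq_le (x : ℝ) : (1 / (1 + |x|)) ^ 2 ≤ (1 + x ^ 2)⁻¹ := by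
  rw [div_pow, one_pow, one_div]
  apply inv_anti₀ (by positivity)
  nlinarith [abs_nonneg x, sq_abs x]

theorem memLp_one_div_one_add_abs (c : ℝ) : MemLp (fun x : ℝ => c / (1 + |x|)) 2 volume := by
  have hm : Measurable (fun x : ℝ => c / (1 + |x|)) := by fun_prop
  rw [memLp_two_iff_integrable_sq hm.aestronglyMeasurable]
  refine (integrable_inv_one_add_sq.const_mul (c ^ 2)).mono' (hm.pow_const 2).aestronglyMeasurable
    (ae_of_all _ fun x => ?_)
  rw [Real.norm_of_nonneg (by positivity), div_eq_mul_one_div, mul_pow]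
  exact mul_le_mul_of_nonneg_left (one_div_one_add_abs_sq_le x) (sq_nonneg c)

theorem memLp_two_of_le {E : Type*} [NormedAddCommGroup E] {f : ℝ → E}
    (hf : AEStronglyMeasurable f volume) {c : ℝ} (h : ∀ x, ‖f x‖ ≤ c / (1 + |x|)) :
    MemLp f 2 volume :=
  (memLp_one_div_one_add_abs c).mono' hf (ae_of_all _ h)

theorem integrable_mul_of_memLp_two {f g : ℝ → ℝ} (hf : MemLp f 2 volume) (hg : MemLp g 2 volume) :
    Integrable (fun x => f x * g x) := hf.integrable_mul hg

/-! ### Cauchy, conjugate Poisson and Poisson kernels. -/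

/-- The truncated Cauchy kernel. -/
noncomputable def truncKernel (ε u : ℝ) : ℝ := if ε < |u| then u⁻¹ else 0

/-- The conjugate Poisson kernel, without the factor `1 / π`. -/
noncomputable def conjKernel (ε u : ℝ) : ℝ := u / (u ^ 2 + ε ^ 2)

/-- The Poisson kernel, without the factor `1 / π`. -/
noncomputable def poissonKernel (ε u : ℝ) : ℝ := ε / (u ^ 2 + ε ^ 2)

theorem measurable_truncKernel (ε : ℝ) : Measurable (truncKernel ε) := by
  unfold truncKernel
  exact Measurable.ite (measurableSet_lt measurable_const measurable_norm) measurable_inv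
    measurable_const

theorem continuous_conjKernel {ε : ℝ} (hε : 0 < ε) : Continuous (conjKernel ε) := by
  unfold conjKernel
  exact continuous_id.div (by fun_prop) fun x => by positivity

theorem continuous_poissonKernel {ε : ℝ} (hε : 0 < ε) : Continuous (poissonKernel ε) := by
  unfold poissonKernel
  exact continuous_const.div (by fun_prop) fun x => by positivity

theorem poissonKernel_nonneg {ε : ℝ} (hε : 0 < ε) (u : ℝ) : 0 ≤ poissonKernel ε u := by
  unfold poissonKernel; positivity

theorem abs_truncKernel_le (ε u : ℝ) : |truncKernel ε u| ≤ |u|⁻¹ := by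
  unfold truncKernel
  split_ifs
  · rw [abs_inv]
  · simp

theorem abs_conjKernel_le (ε u : ℝ) : |conjKernel ε u| ≤ |u|⁻¹ := by
  unfold conjKernel
  rcases eq_or_ne u 0 with rfl | hu
  · simp
  have : 0 < |u| := abs_pos.2 hu
  rw [abs_div, abs_of_nonneg (by positivity : 0 ≤ u ^ 2 + ε ^ 2), div_le_iff₀ (by positivity),
    inv_mul_eq_div, le_div_iff₀ this]
  nlinarith [sq_abs u, sq_nonneg ε]

theorem memLp_truncKernel {ε : ℝ} (hε : 0 < ε) : MemLp (truncKernel ε) 2 volume := by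
  refine memLp_two_of_le (c := 1 + 1 / ε) (measurable_truncKernel ε).aestronglyMeasurable
    fun u => ?_
  unfold truncKernel
  split_ifs with h
  · have : 0 < |u| := hε.trans h
    rw [Real.norm_eq_abs, abs_inv, le_div_iff₀ (by positivity), inv_mul_eq_div,
      div_le_iff₀ this]
    have : 1 ≤ 1 / ε * |u| := by rw [one_div, inv_mul_eq_div, le_div_iff₀ hε]; linarith
    linarith
  · rw [norm_zero]; positivity

theorem memLp_conjKernel {ε : ℝ} (hε : 0 < ε) : MemLp (conjKernel ε) 2 volume := by
  refine memLp_two_of_le (c := 1 + 1 / ε) (continuous_conjKernel hε).aestronglyMeasurable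
    fun u => ?_
  unfold conjKernel
  rw [Real.norm_eq_abs, abs_div, abs_of_nonneg (by positivity : 0 ≤ u ^ 2 + ε ^ 2),
    div_le_div_iff₀ (by positivity) (by positivity)]
  have h2 : |u| * ε ≤ u ^ 2 + ε ^ 2 := by nlinarith [sq_abs u, sq_nonneg (|u| - ε), abs_nonneg u]
  have h3 : |u| ≤ 1 / ε * (u ^ 2 + ε ^ 2) := by
    rw [one_div, inv_mul_eq_div, le_div_iff₀ hε]; exact h2
  nlinarith [sq_abs u, sq_nonneg ε]

/-- For `|u| > ε` the difference is `ε²/(u(u² + ε²))`; for `|u| ≤ ε` only the conjugate kernel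
remains. Sharp truncation thus costs no more than convolution with a positive kernel of mass π. -/
theorem abs_truncKernel_sub_conjKernel_le {ε : ℝ} (hε : 0 < ε) (u : ℝ) :
    |truncKernel ε u - conjKernel ε u| ≤ poissonKernel ε u := by
  unfold truncKernel conjKernel poissonKernel
  split_ifs with h
  · have hu : 0 < |u| := hε.trans h
    have hu' : u ≠ 0 := abs_pos.1 hu
    have : u⁻¹ - u / (u ^ 2 + ε ^ 2) = ε ^ 2 / (u * (u ^ 2 + ε ^ 2)) := by
      field_simp; ring
    rw [this, abs_div, abs_mul, abs_of_nonneg (by positivity : 0 ≤ u ^ 2 + ε ^ 2),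
      abs_of_nonneg (sq_nonneg ε), div_le_div_iff₀ (by positivity) (by positivity)]
    have : ε * ε ≤ ε * |u| := mul_le_mul_of_nonneg_left h.le hε.le
    have h3 : 0 ≤ u ^ 2 + ε ^ 2 := by positivity
    nlinarith [mul_le_mul_of_nonneg_right this h3]
  · rw [zero_sub, abs_neg, abs_div, abs_of_nonneg (by positivity : 0 ≤ u ^ 2 + ε ^ 2)]
    gcongr
    linarith

theorem integrable_poissonKernel {ε : ℝ} (hε : 0 < ε) : Integrable (poissonKernel ε) := by
  have := (integrable_inv_one_add_sq.comp_div hε.ne').const_mul ε⁻¹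
  refine this.congr (ae_of_all _ fun u => ?_)
  simp only [poissonKernel]
  field_simp
  ring

theorem integral_poissonKernel {ε : ℝ} (hε : 0 < ε) : ∫ u, poissonKernel ε u = Real.pi := by
  have h1 : ∀ u, poissonKernel ε u = ε⁻¹ * (1 + (u / ε) ^ 2)⁻¹ := fun u => by
    simp only [poissonKernel]; field_simp; ring
  simp_rw [h1]
  rw [integral_const_mul, Measure.integral_comp_div (fun u : ℝ => (1 + u ^ 2)⁻¹) ε,
    integral_univ_inv_one_add_sq, smul_eq_mul, abs_of_pos hε]
  field_simp

theorem tendsto_conjKernel_cocompact (ε : ℝ) : Tendsto (conjKernel ε) (cocompact ℝ) (𝓝 0) := by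
  refine squeeze_zero_norm (fun u => abs_conjKernel_le ε u) ?_
  exact tendsto_inv_atTop_zero.comp (tendsto_norm_cocompact_atTop (E := ℝ))

theorem tendsto_poissonKernel_cocompact {ε : ℝ} (hε : 0 < ε) :
    Tendsto (poissonKernel ε) (cocompact ℝ) (𝓝 0) := by
  have h := (tendsto_inv_atTop_zero.comp (tendsto_norm_cocompact_atTop (E := ℝ))).const_mul 1
  rw [mul_zero] at h
  refine squeeze_zero_norm' ?_ h
  filter_upwards [(tendsto_norm_cocompact_atTop (E := ℝ)).eventually_ge_atTop ε] with u hu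
  have hu0 : 0 < |u| := hε.trans_le hu
  rw [Real.norm_of_nonneg (poissonKernel_nonneg hε u)]
  simp only [poissonKernel, Function.comp, one_mul, Real.norm_eq_abs] at hu ⊢
  rw [← one_div, div_le_div_iff₀ (by positivity) hu0]
  nlinarith [sq_abs u, sq_nonneg ε, mul_le_mul_of_nonneg_right hu hu0.le]

theorem tendsto_log_quotient_cocompact {ε : ℝ} (hε : 0 < ε) (d : ℝ) :
    Tendsto (fun u : ℝ => Real.log ((u ^ 2 + ε ^ 2) / ((u + d) ^ 2 + ε ^ 2)))
      (cocompact ℝ) (𝓝 0) := by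
  have hd : Tendsto (fun u : ℝ => u + d) (cocompact ℝ) (cocompact ℝ) :=
    (Homeomorph.addRight d).isClosedEmbedding.tendsto_cocompact
  have h1 : Tendsto (fun u : ℝ => 1 - 2 * d * conjKernel ε (u + d)
      + d ^ 2 / ε * poissonKernel ε (u + d)) (cocompact ℝ) (𝓝 1) := by
    have := (((tendsto_conjKernel_cocompact ε).comp hd).const_mul (2 * d)).const_sub 1 |>.add
      (((tendsto_poissonKernel_cocompact hε).comp hd).const_mul (d ^ 2 / ε))
    simpa using this
  have h2 : ∀ u : ℝ, (u ^ 2 + ε ^ 2) / ((u + d) ^ 2 + ε ^ 2) = 1 - 2 * d * conjKernel ε (u + d)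
      + d ^ 2 / ε * poissonKernel ε (u + d) := fun u => by
    simp only [conjKernel, poissonKernel]
    have : (u + d) ^ 2 + ε ^ 2 ≠ 0 := by positivity
    field_simp
    ring
  simp_rw [h2]
  simpa using h1.log one_ne_zero

/-- Partial fractions give a primitive made of a logarithm and two arctangents, with coefficients
`α` and `β`. The logarithm vanishes at both ends, so only `2πβ/ε` survives. The coefficient `α` has
a factor `d` in its denominator. -/
theorem integral_conjKernel_mul_conjKernel {ε : ℝ} (hε : 0 < ε) {d : ℝ} (hd : d ≠ 0) :
    ∫ u, conjKernel ε u * conjKernel ε (u + d) = Real.pi * poissonKernel (2 * ε) d := by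
  set β : ℝ := ε ^ 2 / (d ^ 2 + 4 * ε ^ 2) with hβ
  set α : ℝ := (d ^ 2 + 2 * ε ^ 2) / (d * (d ^ 2 + 4 * ε ^ 2)) with hα
  have hint : Integrable (fun u => conjKernel ε u * conjKernel ε (u + d)) :=
    integrable_mul_of_memLp_two (memLp_conjKernel hε)
      ((memLp_conjKernel hε).comp_measurePreserving (measurePreserving_add_right volume d))
  have hderiv : ∀ u, HasDerivAt (fun u : ℝ => α / 2 *
      Real.log ((u ^ 2 + ε ^ 2) / ((u + d) ^ 2 + ε ^ 2)) +
      β / ε * (Real.arctan (u / ε) + Real.arctan ((u + d) / ε)))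
      (conjKernel ε u * conjKernel ε (u + d)) u := by
    intro u
    have p1 : u ^ 2 + ε ^ 2 ≠ 0 := by positivity
    have p2 : (u + d) ^ 2 + ε ^ 2 ≠ 0 := by positivity
    have e1 : HasDerivAt (fun u : ℝ => u ^ 2 + ε ^ 2) (2 * u) u := by
      simpa using ((hasDerivAt_id u).pow 2).add_const (ε ^ 2)
    have e2 : HasDerivAt (fun u : ℝ => (u + d) ^ 2 + ε ^ 2) (2 * (u + d)) u := by
      simpa using (((hasDerivAt_id u).add_const d).pow 2).add_const (ε ^ 2)
    have e3 := ((e1.div e2 p2).log (div_ne_zero p1 p2)).const_mul (α / 2)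
    have e4 : HasDerivAt (fun u : ℝ => Real.arctan (u / ε)) (1 / (1 + (u / ε) ^ 2) * (1 / ε)) u :=
      ((hasDerivAt_id u).div_const ε).arctan
    have e5 : HasDerivAt (fun u : ℝ => Real.arctan ((u + d) / ε))
        (1 / (1 + ((u + d) / ε) ^ 2) * (1 / ε)) u :=
      (((hasDerivAt_id u).add_const d).div_const ε).arctan
    refine (e3.add ((e4.add e5).const_mul (β / ε))).congr_deriv ?_
    have q : d ^ 2 + 4 * ε ^ 2 ≠ 0 := by positivity
    have r1 : 1 / (1 + (u / ε) ^ 2) * (1 / ε) = ε / (u ^ 2 + ε ^ 2) := by field_simp; ring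
    have r2 : 1 / (1 + ((u + d) / ε) ^ 2) * (1 / ε) = ε / ((u + d) ^ 2 + ε ^ 2) := by
      have : ε ^ 2 + (u + d) ^ 2 ≠ 0 := by positivity
      field_simp; ring
    rw [r1, r2, hα, hβ]
    simp only [conjKernel, Pi.div_apply]
    field_simp
    ring
  have hend : ∀ {l : Filter ℝ} {c : ℝ}, l ≤ cocompact ℝ →
      Tendsto (fun u => Real.arctan (u / ε)) l (𝓝 c) →
      Tendsto (fun u => Real.arctan ((u + d) / ε)) l (𝓝 c) →
      Tendsto (fun u : ℝ => α / 2 *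
      Real.log ((u ^ 2 + ε ^ 2) / ((u + d) ^ 2 + ε ^ 2)) +
      β / ε * (Real.arctan (u / ε) + Real.arctan ((u + d) / ε))) l (𝓝 (β / ε * (c + c))) := by
    intro l c hl h1 h2
    have := (((tendsto_log_quotient_cocompact hε d).mono_left hl).const_mul (α / 2)).add
      ((h1.add h2).const_mul (β / ε))
    simpa using this
  have hbot := hend atBot_le_cocompact
    (tendsto_nhds_of_tendsto_nhdsWithin Real.tendsto_arctan_atBot |>.comp
      (tendsto_id.atBot_div_const hε))
    (tendsto_nhds_of_tendsto_nhdsWithin Real.tendsto_arctan_atBot |>.comp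
      ((tendsto_atBot_add_const_right _ d tendsto_id).atBot_div_const hε))
  have htop := hend atTop_le_cocompact
    (tendsto_nhds_of_tendsto_nhdsWithin Real.tendsto_arctan_atTop |>.comp
      (tendsto_id.atTop_div_const hε))
    (tendsto_nhds_of_tendsto_nhdsWithin Real.tendsto_arctan_atTop |>.comp
      ((tendsto_atTop_add_const_right _ d tendsto_id).atTop_div_const hε))
  rw [integral_of_hasDerivAt_of_tendsto hderiv hint hbot htop, hβ]
  simp only [poissonKernel]
  field_simp
  ring

/-! ### Uniform L² bounds for the regularized kernels. -/

theorem eLpNorm_two_eq_sqrt {f : ℝ → ℝ} (hf : MemLp f 2 volume) :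
    eLpNorm f 2 volume = ENNReal.ofReal (√(∫ x, f x ^ 2)) := by
  rw [hf.eLpNorm_eq_integral_rpow_norm (by norm_num) (by norm_num), Real.sqrt_eq_rpow]
  simp

theorem integrable_and_integral_mul_poissonKernel_sub {ε : ℝ} (hε : 0 < ε) {f : ℝ → ℝ}
    (hf : Integrable f) :
    Integrable (fun p : ℝ × ℝ => f p.2 * poissonKernel ε (p.1 - p.2)) (volume.prod volume) ∧
    ∫ p : ℝ × ℝ, f p.2 * poissonKernel ε (p.1 - p.2) ∂(volume.prod volume)
      = Real.pi * ∫ x, f x := by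
  have h := hf.convolution_integrand (ContinuousLinearMap.mul ℝ ℝ) (integrable_poissonKernel hε)
  simp only [ContinuousLinearMap.mul_apply'] at h
  refine ⟨h, ?_⟩
  rw [integral_prod_symm _ h]
  simp_rw [integral_const_mul, integral_sub_right_eq_self (poissonKernel ε),
    integral_poissonKernel hε,
    integral_mul_const]
  ring

theorem integral_conjKernel_translates {ε : ℝ} (hε : 0 < ε) {a b : ℝ} (hab : a ≠ b) :
    ∫ x, conjKernel ε (a - x) * conjKernel ε (b - x) = Real.pi * poissonKernel (2 * ε) (a - b) := by
  have h1 := integral_sub_left_eq_self (fun u => conjKernel ε u * conjKernel ε (u + (b - a)))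
    volume a
  rw [integral_conjKernel_mul_conjKernel hε (sub_ne_zero.2 hab.symm)] at h1
  have h2 : poissonKernel (2 * ε) (a - b) = poissonKernel (2 * ε) (b - a) := by
    simp only [poissonKernel]; congr 2; ring
  rw [h2, ← h1]
  congr with x
  congr 2
  ring

/-- The `L²` bound for convolution with the conjugate Poisson kernel, for integrable data. -/
theorem eLpNorm_conjKernel_integral_le_of_integrable {ε : ℝ} (hε : 0 < ε) {f : ℝ → ℝ}
    (hf1 : Integrable f) (hf : MemLp f 2 volume) :
    eLpNorm (fun x => ∫ a, f a * conjKernel ε (a - x)) 2 volume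
      ≤ ENNReal.ofReal Real.pi * eLpNorm f 2 volume := by
  set Q := conjKernel ε with hQ
  have hQc : Continuous Q := continuous_conjKernel hε
  have hQ2 : Integrable (fun u => Q u ^ 2) := (memLp_conjKernel hε).integrable_sq
  have hf2 : Integrable (fun u => f u ^ 2) := hf.integrable_sq
  have hff : Integrable (fun p : ℝ × ℝ => f p.1 * f p.2) (volume.prod volume) := hf1.mul_prod hf1
  set F : ℝ → ℝ × ℝ → ℝ := fun x p => f p.1 * f p.2 * (Q (p.1 - x) * Q (p.2 - x)) with hF
  have hQQ : ∀ a b : ℝ, Integrable (fun x => Q (a - x) * Q (b - x)) := fun a b =>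
    integrable_mul_of_memLp_two
      ((memLp_conjKernel hε).comp_measurePreserving (Measure.measurePreserving_sub_left volume a))
      ((memLp_conjKernel hε).comp_measurePreserving (Measure.measurePreserving_sub_left volume b))
  have hFm : AEStronglyMeasurable (Function.uncurry F) (volume.prod (volume.prod volume)) := by
    refine (hff.aestronglyMeasurable.comp_snd).mul ?_
    exact Continuous.aestronglyMeasurable (by fun_prop)
  -- Fubini for the triple integral: integrability of `f` controls the variables `(a, b)`, and `|Q(a
  -- - x)Q(b - x)|` has integral over `x` at most `∫ Q²`, uniformly in `a` and `b`.
  have hFint : Integrable (Function.uncurry F) (volume.prod (volume.prod volume)) := by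
    rw [integrable_prod_iff' hFm]
    constructor
    · exact ae_of_all _ fun p => (hQQ p.1 p.2).const_mul (f p.1 * f p.2)
    · refine (hff.norm.mul_const (∫ u, Q u ^ 2)).mono' hFm.norm.prod_swap.integral_prod_right'
        (ae_of_all _ fun p => ?_)
      rw [Real.norm_of_nonneg (integral_nonneg fun _ => norm_nonneg _)]
      simp only [Function.uncurry, hF, norm_mul, integral_const_mul]
      refine mul_le_mul_of_nonneg_left ?_ (by positivity)
      have i1 := hQ2.comp_sub_left p.1
      have i2 := hQ2.comp_sub_left p.2
      calc ∫ x, ‖Q (p.1 - x)‖ * ‖Q (p.2 - x)‖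
          ≤ ∫ x, (1 / 2 * Q (p.1 - x) ^ 2 + 1 / 2 * Q (p.2 - x) ^ 2) := by
            refine integral_mono ?_ ((i1.const_mul _).add (i2.const_mul _)) fun x => ?_
            · exact (hQQ p.1 p.2).norm.congr (ae_of_all _ fun x => norm_mul _ _)
            · simp only [Real.norm_eq_abs]
              nlinarith [sq_nonneg (|Q (p.1 - x)| - |Q (p.2 - x)|), sq_abs (Q (p.1 - x)),
                sq_abs (Q (p.2 - x))]
        _ = ∫ u, Q u ^ 2 := by
            rw [integral_add (i1.const_mul _) (i2.const_mul _), integral_const_mul,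
              integral_const_mul, integral_sub_left_eq_self (fun u => Q u ^ 2),
              integral_sub_left_eq_self (fun u => Q u ^ 2)]
            ring
  set S : ℝ → ℝ := fun x => ∫ a, f a * Q (a - x) with hS
  have hSF : ∀ x, S x ^ 2 = ∫ p, F x p ∂(volume.prod volume) := fun x => by
    rw [sq, hS]
    simp only
    rw [← integral_prod_mul]
    congr with p
    simp only [hF]; ring
  have hS2 : Integrable (fun x => S x ^ 2) := by
    simp_rw [hSF]
    exact hFint.integral_prod_left
  have hSm : AEStronglyMeasurable S volume := by
    have hm : AEStronglyMeasurable (fun p : ℝ × ℝ => f p.2 * Q (p.2 - p.1)) (volume.prod volume) :=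
      (hf.aestronglyMeasurable.comp_snd).mul (Continuous.aestronglyMeasurable (by fun_prop))
    exact hm.integral_prod_right'
  have hSL : MemLp S 2 volume := (memLp_two_iff_integrable_sq hSm).2 hS2
  obtain ⟨j1, k1⟩ := integrable_and_integral_mul_poissonKernel_sub (mul_pos two_pos hε) hf2
  have k2 : ∫ p : ℝ × ℝ, f p.1 ^ 2 * poissonKernel (2 * ε) (p.2 - p.1) ∂(volume.prod volume)
      = Real.pi * ∫ x, f x ^ 2 := by rw [← k1, ← integral_prod_swap]; rfl
  have j2 : Integrable (fun p : ℝ × ℝ => f p.1 ^ 2 * poissonKernel (2 * ε) (p.2 - p.1))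
    (volume.prod volume) := j1.swap
  -- The product formula for translates is available off the diagonal, which is a null set.
  have hne : ∀ᵐ p : ℝ × ℝ ∂(volume.prod volume), p.1 ≠ p.2 := by
    refine (Measure.ae_prod_iff_ae_ae ?_).2 (ae_of_all _ fun a => ?_)
    · exact (isClosed_eq continuous_fst continuous_snd).measurableSet.compl
    · filter_upwards [Measure.ae_ne volume a] with b hb using hb.symm
  -- Integrating `x` out first gives `∫ S² = π ∬ f(a) f(b) P_{2ε}(a - b)`. Then `f(a)f(b) ≤ (f(a)² +
  -- f(b)²)/2` and the mass π of the Poisson kernel yield `π²`.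
  have hmain : ∫ x, S x ^ 2 ≤ Real.pi ^ 2 * ∫ x, f x ^ 2 := by
    simp_rw [hSF]
    rw [integral_integral_swap hFint]
    calc ∫ p : ℝ × ℝ, ∫ x, F x p ∂volume ∂(volume.prod volume)
        ≤ ∫ p : ℝ × ℝ, (Real.pi / 2 * (f p.2 ^ 2 * poissonKernel (2 * ε) (p.1 - p.2)) +
          Real.pi / 2 * (f p.1 ^ 2 * poissonKernel (2 * ε) (p.2 - p.1))) ∂(volume.prod volume) := by
          refine integral_mono_ae hFint.integral_prod_right
            ((j1.const_mul _).add (j2.const_mul _)) ?_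
          filter_upwards [hne] with p hp
          simp only [hF, integral_const_mul]
          rw [integral_conjKernel_translates hε hp]
          have h0 := poissonKernel_nonneg (mul_pos two_pos hε) (p.1 - p.2)
          have h2 : poissonKernel (2 * ε) (p.2 - p.1) = poissonKernel (2 * ε) (p.1 - p.2) := by
            simp only [poissonKernel]; congr 2; ring
          rw [h2]
          have := mul_nonneg (mul_nonneg Real.pi_pos.le h0) (sq_nonneg (f p.1 - f p.2))
          nlinarith
      _ = Real.pi ^ 2 * ∫ x, f x ^ 2 := by
          rw [integral_add (j1.const_mul _) (j2.const_mul _), integral_const_mul,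
            integral_const_mul, k1, k2]
          ring
  rw [eLpNorm_two_eq_sqrt hSL, eLpNorm_two_eq_sqrt hf,
    ← ENNReal.ofReal_mul Real.pi_pos.le]
  apply ENNReal.ofReal_le_ofReal
  rw [← Real.sqrt_sq Real.pi_pos.le, ← Real.sqrt_mul (sq_nonneg _)]
  exact Real.sqrt_le_sqrt hmain

theorem aestronglyMeasurable_integral_mul_translate {f k : ℝ → ℝ}
    (hf : AEStronglyMeasurable f volume) (hk : Measurable k) :
    AEStronglyMeasurable (fun x => ∫ a, f a * k (a - x)) volume := by
  have hm : AEStronglyMeasurable (fun p : ℝ × ℝ => f p.2 * k (p.2 - p.1)) (volume.prod volume) :=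
    (hf.comp_snd).mul (hk.comp (measurable_snd.sub measurable_fst)).aestronglyMeasurable
  exact hm.integral_prod_right'

theorem integrable_mul_translate {f k : ℝ → ℝ} (hf : MemLp f 2 volume) (hk : MemLp k 2 volume)
    (x : ℝ) : Integrable (fun a => f a * k (a - x)) :=
  integrable_mul_of_memLp_two hf
    (hk.comp_measurePreserving (measurePreserving_sub_right volume x))

/-- The constant does not see the L¹ norm, so cutting `f` off to `[-n, n]` and Fatou remove the
integrability assumption. -/
theorem eLpNorm_conjKernel_integral_le {ε : ℝ} (hε : 0 < ε) {f : ℝ → ℝ} (hf : MemLp f 2 volume) :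
    eLpNorm (fun x => ∫ a, f a * conjKernel ε (a - x)) 2 volume
      ≤ ENNReal.ofReal Real.pi * eLpNorm f 2 volume := by
  set g : ℕ → ℝ → ℝ := fun n => (Set.Icc (-(n : ℝ)) n).indicator f with hg
  have hgL : ∀ n, MemLp (g n) 2 volume := fun n => hf.indicator measurableSet_Icc
  have hg1 : ∀ n, Integrable (g n) := fun n => by
    have h1 : MemLp f 2 (volume.restrict (Set.Icc (-(n : ℝ)) n)) := hf.restrict _
    exact (integrable_indicator_iff measurableSet_Icc).2 (h1.integrable (by norm_num))
  have hlim : ∀ x, Tendsto (fun n => ∫ a, g n a * conjKernel ε (a - x)) atTop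
      (𝓝 (∫ a, f a * conjKernel ε (a - x))) := by
    intro x
    have hi := integrable_mul_translate hf (memLp_conjKernel hε) x
    refine tendsto_integral_of_dominated_convergence (fun a => ‖f a * conjKernel ε (a - x)‖)
      (fun n => (integrable_mul_translate (hgL n) (memLp_conjKernel hε) x).aestronglyMeasurable)
      hi.norm (fun n => ae_of_all _ fun a => ?_) (ae_of_all _ fun a => ?_)
    · rw [norm_mul, norm_mul]
      exact mul_le_mul_of_nonneg_right (norm_indicator_le_norm_self _ _) (norm_nonneg _)
    · refine tendsto_const_nhds.congr' ?_
      filter_upwards [eventually_ge_atTop ⌈|a|⌉₊] with n hn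
      have : |a| ≤ n := (Nat.le_ceil _).trans (by exact_mod_cast hn)
      simp only [hg]
      rw [Set.indicator_of_mem (Set.mem_Icc.2 (abs_le.1 this))]
  refine (Lp.eLpNorm_lim_le_liminf_eLpNorm (fun n => aestronglyMeasurable_integral_mul_translate
    (hgL n).aestronglyMeasurable (continuous_conjKernel hε).measurable) _
    (ae_of_all _ hlim)).trans ?_
  refine liminf_le_of_frequently_le' (Frequently.of_forall fun n => ?_)
  refine (eLpNorm_conjKernel_integral_le_of_integrable hε (hg1 n) (hgL n)).trans ?_
  gcongr
  exact eLpNorm_indicator_le f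

/-- Cauchy–Schwarz against a finite measure. -/
theorem lintegral_sq_le {α : Type*} [MeasurableSpace α] (μ : Measure α) {g : α → ENNReal}
    (hg : AEMeasurable g μ) : (∫⁻ x, g x ∂μ) ^ 2 ≤ μ Set.univ * ∫⁻ x, g x ^ 2 ∂μ := by
  have h := ENNReal.lintegral_mul_le_Lp_mul_Lq μ Real.HolderConjugate.two_two
    (aemeasurable_const (b := (1 : ENNReal))) hg
  simp only [Pi.mul_apply, one_mul, ENNReal.one_rpow, lintegral_const] at h
  calc (∫⁻ x, g x ∂μ) ^ 2
      ≤ (μ Set.univ ^ (1 / 2 : ℝ) * (∫⁻ x, g x ^ (2 : ℝ) ∂μ) ^ (1 / 2 : ℝ)) ^ 2 := by gcongr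
    _ = _ := by
      rw [mul_pow, ← ENNReal.rpow_natCast, ← ENNReal.rpow_natCast, ← ENNReal.rpow_mul,
        ← ENNReal.rpow_mul]
      norm_num

/-- Minkowski's inequality for an average of translates. -/
theorem lintegral_translates_sq_le (μ : Measure ℝ) [SFinite μ] (c : ℝ) {g : ℝ → ENNReal}
    (hg : Measurable g) :
    ∫⁻ x, (∫⁻ θ, g (x + c * θ) ∂μ) ^ 2 ≤ μ Set.univ ^ 2 * ∫⁻ x, g x ^ 2 := by
  calc ∫⁻ x, (∫⁻ θ, g (x + c * θ) ∂μ) ^ 2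
      ≤ ∫⁻ x, μ Set.univ * ∫⁻ θ, g (x + c * θ) ^ 2 ∂μ :=
        lintegral_mono fun x => lintegral_sq_le μ (hg.comp (by fun_prop)).aemeasurable
    _ = μ Set.univ * ∫⁻ x, ∫⁻ θ, g (x + c * θ) ^ 2 ∂μ := by
        rw [lintegral_const_mul]
        exact Measurable.lintegral_prod_right' (f := fun p : ℝ × ℝ => g (p.1 + c * p.2) ^ 2)
          ((hg.comp (by fun_prop)).pow_const 2)
    _ = μ Set.univ * ∫⁻ θ, ∫⁻ x, g (x + c * θ) ^ 2 ∂volume ∂μ := by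
        rw [lintegral_lintegral_swap]
        exact ((hg.comp (by fun_prop)).pow_const 2).aemeasurable
    _ = μ Set.univ ^ 2 * ∫⁻ x, g x ^ 2 := by
        simp_rw [lintegral_add_right_eq_self (fun x => g x ^ 2), lintegral_const]
        ring

theorem eLpNorm_two_sq {E : Type*} [NormedAddCommGroup E] (f : ℝ → E) :
    eLpNorm f 2 volume ^ 2 = ∫⁻ x, ‖f x‖ₑ ^ 2 := by
  rw [eLpNorm_eq_lintegral_rpow_enorm_toReal (by norm_num) (by norm_num), ← ENNReal.rpow_natCast,
    ← ENNReal.rpow_mul]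
  norm_num

theorem eLpNorm_translates_le {E F : Type*} [NormedAddCommGroup E] [NormedAddCommGroup F]
    (μ : Measure ℝ) [SFinite μ] (c : ℝ) {g : ℝ → E} (hg : StronglyMeasurable g)
    {G : ℝ → F} (hG : ∀ x, ‖G x‖ₑ ≤ ∫⁻ θ, ‖g (x + c * θ)‖ₑ ∂μ) :
    eLpNorm G 2 volume ≤ μ Set.univ * eLpNorm g 2 volume := by
  rw [← ENNReal.pow_le_pow_left_iff two_ne_zero, mul_pow, eLpNorm_two_sq, eLpNorm_two_sq]
  refine le_trans (lintegral_mono fun x => ?_) (lintegral_translates_sq_le μ c hg.enorm)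
  gcongr
  exact hG x

/-- The constant is π + π: one π from the conjugate Poisson kernel, the other from the difference of
kernels, an average of translates against a Poisson density of mass π. -/
theorem eLpNorm_truncKernel_integral_le {ε : ℝ} (hε : 0 < ε) {f : ℝ → ℝ}
    (hf : MemLp f 2 volume) :
    eLpNorm (fun x => ∫ a, f a * truncKernel ε (a - x)) 2 volume
      ≤ ENNReal.ofReal (2 * Real.pi) * eLpNorm f 2 volume := by
  set D : ℝ → ℝ := fun x => ∫ a, f a * (truncKernel ε (a - x) - conjKernel ε (a - x)) with hD
  have hsplit : (fun x => ∫ a, f a * truncKernel ε (a - x))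
      = (fun x => ∫ a, f a * conjKernel ε (a - x)) + D := by
    ext x
    simp only [Pi.add_apply, hD, mul_sub]
    rw [integral_sub (integrable_mul_translate hf (memLp_truncKernel hε) x)
      (integrable_mul_translate hf (memLp_conjKernel hε) x)]
    ring
  have hDm : AEStronglyMeasurable D volume :=
    aestronglyMeasurable_integral_mul_translate (k := fun u => truncKernel ε u - conjKernel ε u)
      hf.aestronglyMeasurable
      ((measurable_truncKernel ε).sub (continuous_conjKernel hε).measurable)
  have hDle : eLpNorm D 2 volume ≤ ENNReal.ofReal Real.pi * eLpNorm f 2 volume := by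
    set μ : Measure ℝ := volume.withDensity fun u => ENNReal.ofReal (poissonKernel ε u) with hμ
    have hPm : Measurable fun u => ENNReal.ofReal (poissonKernel ε u) :=
      (continuous_poissonKernel hε).measurable.ennreal_ofReal
    have huniv : μ Set.univ = ENNReal.ofReal Real.pi := by
      rw [hμ, withDensity_apply _ MeasurableSet.univ, Measure.restrict_univ,
        ← ofReal_integral_eq_lintegral_ofReal (integrable_poissonKernel hε)
          (ae_of_all _ fun u => poissonKernel_nonneg hε u), integral_poissonKernel hε]
    have hmk := hf.aestronglyMeasurable
    rw [← huniv, eLpNorm_congr_ae hmk.ae_eq_mk]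
    refine eLpNorm_translates_le μ 1 hmk.stronglyMeasurable_mk fun x => ?_
    have e1 : D x = ∫ a, hmk.mk f a * (truncKernel ε (a - x) - conjKernel ε (a - x)) := by
      refine integral_congr_ae ?_
      filter_upwards [hmk.ae_eq_mk] with a ha
      rw [ha]
    rw [e1]
    refine (enorm_integral_le_lintegral_enorm _).trans ?_
    have hG : Measurable fun θ => ‖hmk.mk f (x + 1 * θ)‖ₑ :=
      (hmk.stronglyMeasurable_mk.measurable.comp (by fun_prop)).enorm
    rw [hμ, lintegral_withDensity_eq_lintegral_mul _ hPm hG]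
    refine le_of_le_of_eq (lintegral_mono fun a => ?_) (lintegral_sub_right_eq_self _ x)
    simp only [Pi.mul_apply, one_mul, add_sub_cancel, enorm_mul]
    rw [mul_comm]
    gcongr
    rw [Real.enorm_eq_ofReal_abs]
    exact ENNReal.ofReal_le_ofReal (abs_truncKernel_sub_conjKernel_le hε _)
  rw [hsplit]
  refine (eLpNorm_add_le (aestronglyMeasurable_integral_mul_translate hf.aestronglyMeasurable
    (continuous_conjKernel hε).measurable) hDm (by norm_num)).trans ?_
  rw [two_mul, ENNReal.ofReal_add Real.pi_pos.le Real.pi_pos.le, add_mul]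
  exact add_le_add (eLpNorm_conjKernel_integral_le hε hf) hDle

/-! ### Principal values of L² functions. -/

theorem measurableSet_lt_abs_sub (ε a : ℝ) : MeasurableSet {ζ : ℝ | ε < |ζ - a|} :=
  measurableSet_lt measurable_const (by fun_prop)

theorem mul_truncKernel_eq_indicator (f : ℝ → ℝ) (ε a : ℝ) :
    (fun ζ => f ζ * truncKernel ε (ζ - a))
      = {ζ : ℝ | ε < |ζ - a|}.indicator fun ζ => f ζ / (ζ - a) := by
  ext ζ
  simp only [truncKernel, Set.indicator_apply, Set.mem_ofPred_eq]
  split_ifs <;> simp [div_eq_mul_inv]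

theorem setIntegral_eq_integral_truncKernel (f : ℝ → ℝ) (ε a : ℝ) :
    ∫ ζ in {ζ : ℝ | ε < |ζ - a|}, f ζ / (ζ - a) = ∫ ζ, f ζ * truncKernel ε (ζ - a) := by
  rw [mul_truncKernel_eq_indicator, integral_indicator (measurableSet_lt_abs_sub ε a)]

theorem hasPVIntegral_iff {f : ℝ → ℝ} (hf : MemLp f 2 volume) {a v : ℝ} :
    HasPVIntegral f a v ↔
      Tendsto (fun ε => ∫ ζ, f ζ * truncKernel ε (ζ - a)) (𝓝[>] 0) (𝓝 v) := by
  simp only [HasPVIntegral, setIntegral_eq_integral_truncKernel]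
  refine ⟨fun h => h.2, fun h => ⟨fun ε hε => ?_, h⟩⟩
  rw [← integrable_indicator_iff (measurableSet_lt_abs_sub ε a), ← mul_truncKernel_eq_indicator]
  exact integrable_mul_translate hf (memLp_truncKernel hε) a

theorem HasPVIntegral.sub {f g : ℝ → ℝ} {a v w : ℝ} (hf : HasPVIntegral f a v)
    (hg : HasPVIntegral g a w) : HasPVIntegral (fun ζ => f ζ - g ζ) a (v - w) := by
  refine ⟨fun ε hε => ?_, (hf.2.sub hg.2).congr' ?_⟩
  · exact ((hf.1 ε hε).sub (hg.1 ε hε)).congr (ae_of_all _ fun ζ => by simp [sub_div])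
  · filter_upwards [self_mem_nhdsWithin] with ε hε
    rw [← integral_sub (hf.1 ε hε) (hg.1 ε hε)]
    simp only [sub_div]

theorem HasPVIntegral.congr_ae {f g : ℝ → ℝ} {a v : ℝ} (hf : HasPVIntegral f a v)
    (hfg : f =ᵐ[volume] g) : HasPVIntegral g a v := by
  have h : (fun ζ => f ζ / (ζ - a)) =ᵐ[volume] fun ζ => g ζ / (ζ - a) := by
    filter_upwards [hfg] with ζ hζ
    rw [hζ]
  refine ⟨fun ε hε => (hf.1 ε hε).congr (ae_restrict_of_ae h), hf.2.congr fun ε => ?_⟩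
  exact integral_congr_ae (ae_restrict_of_ae h)

theorem HasPVIntegral.comp_add_right {f : ℝ → ℝ} {a v : ℝ} (h : ℝ)
    (hf : HasPVIntegral f (a + h) v) : HasPVIntegral (fun ζ => f (ζ + h)) a v := by
  have key : ∀ ε, (fun ζ => f (ζ + h) * truncKernel ε (ζ - a))
      = fun ζ => (fun z => f z * truncKernel ε (z - (a + h))) (ζ + h) := fun ε => by
    ext ζ
    simp only
    congr 2
    ring
  refine ⟨fun ε hε => ?_, hf.2.congr fun ε => ?_⟩
  · have h1 := hf.1 ε hε
    rw [← integrable_indicator_iff (measurableSet_lt_abs_sub ε _),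
      ← mul_truncKernel_eq_indicator] at h1 ⊢
    rw [key]
    exact h1.comp_add_right h
  · rw [setIntegral_eq_integral_truncKernel, setIntegral_eq_integral_truncKernel, key,
      integral_add_right_eq_self (fun z => f z * truncKernel ε (z - (a + h)))]

theorem hasPVIntegral_zero (a : ℝ) : HasPVIntegral (fun _ => 0) a 0 := by
  rw [hasPVIntegral_iff (MemLp.zero' (μ := volume) (p := 2))]
  simp

/-- The principal value integral is bounded on `L²`. -/
theorem memLp_and_eLpNorm_le_of_hasPVIntegral {f v : ℝ → ℝ} (hf : MemLp f 2 volume)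
    (hv : ∀ᵐ x, HasPVIntegral f x (v x)) :
    MemLp v 2 volume ∧
      eLpNorm v 2 volume ≤ ENNReal.ofReal (2 * Real.pi) * eLpNorm f 2 volume := by
  have hε : ∀ n : ℕ, (0 : ℝ) < 1 / ((n : ℝ) + 1) := fun n => by positivity
  have hε0 : Tendsto (fun n : ℕ => 1 / ((n : ℝ) + 1)) atTop (𝓝[>] 0) :=
    tendsto_nhdsWithin_iff.2 ⟨tendsto_one_div_add_atTop_nhds_zero_nat,
      Eventually.of_forall fun n => hε n⟩
  have hlim : ∀ᵐ x, Tendsto (fun n : ℕ => ∫ ζ, f ζ * truncKernel (1 / ((n : ℝ) + 1)) (ζ - x))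
      atTop (𝓝 (v x)) := by
    filter_upwards [hv] with x hx
    exact ((hasPVIntegral_iff hf).1 hx).comp hε0
  have hm := fun n : ℕ => aestronglyMeasurable_integral_mul_translate hf.aestronglyMeasurable
    (measurable_truncKernel (1 / ((n : ℝ) + 1)))
  have hle : eLpNorm v 2 volume ≤ ENNReal.ofReal (2 * Real.pi) * eLpNorm f 2 volume :=
    -- Fatou along `ε = 1/(n + 1)`: no maximal function is needed, since convergence almost
    -- everywhere is assumed.
    (Lp.eLpNorm_lim_le_liminf_eLpNorm hm _ hlim).trans
      (liminf_le_of_frequently_le' (Frequently.of_forall fun n =>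
        eLpNorm_truncKernel_integral_le (hε n) hf))
  exact ⟨⟨aestronglyMeasurable_of_tendsto_ae atTop hm hlim,
    hle.trans_lt (ENNReal.mul_lt_top ENNReal.ofReal_lt_top hf.2)⟩, hle⟩

/-! ### The singular integral relation and its L² stability. -/

/-- `u = -R - (1/π) p.v. ∫ I(ζ) / (ζ - ·) dζ` almost everywhere. -/
def IsRieszSum (R I u : ℝ → ℝ) : Prop :=
  ∀ᵐ x, ∃ v, HasPVIntegral I x v ∧ u x = -R x - 1 / Real.pi * v

theorem IsRieszSum.exists_fun {R I u : ℝ → ℝ} (h : IsRieszSum R I u) :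
    ∃ v : ℝ → ℝ, (∀ᵐ x, HasPVIntegral I x (v x)) ∧
      u =ᵐ[volume] fun x => -R x - 1 / Real.pi * v x := by
  classical
  refine ⟨fun x => if hx : ∃ v, HasPVIntegral I x v ∧ u x = -R x - 1 / Real.pi * v then hx.choose
    else 0, ?_, ?_⟩
  · filter_upwards [h] with x hx
    rw [dif_pos hx]
    exact hx.choose_spec.1
  · filter_upwards [h] with x hx
    rw [dif_pos hx]
    exact hx.choose_spec.2

theorem IsRieszSum.zero : IsRieszSum (fun _ => 0) (fun _ => 0) (fun _ => 0) :=
  ae_of_all _ fun x => ⟨0, hasPVIntegral_zero x, by simp⟩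

theorem IsRieszSum.congr_ae {R I u R' I' u' : ℝ → ℝ} (h : IsRieszSum R I u)
    (hR : R =ᵐ[volume] R') (hI : I =ᵐ[volume] I') (hu : u =ᵐ[volume] u') :
    IsRieszSum R' I' u' := by
  filter_upwards [h, hR, hu] with x ⟨v, hv, hx⟩ h1 h2
  exact ⟨v, hv.congr_ae hI, by rw [← h1, ← h2, hx]⟩

theorem IsRieszSum.comp_add_right {R I u : ℝ → ℝ} (h : IsRieszSum R I u) (c : ℝ) :
    IsRieszSum (fun x => R (x + c)) (fun x => I (x + c)) (fun x => u (x + c)) := by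
  have := (measurePreserving_add_right (volume : Measure ℝ) c).quasiMeasurePreserving.ae h
  filter_upwards [this] with x ⟨v, hv, hx⟩
  exact ⟨v, hv.comp_add_right c, hx⟩

/-- The basic `L²` comparison estimate for two instances of the singular integral relation. -/
theorem IsRieszSum.eLpNorm_sub_le {R₁ R₂ I₁ I₂ u₁ u₂ g : ℝ → ℝ} (h₁ : IsRieszSum R₁ I₁ u₁)
    (h₂ : IsRieszSum R₂ I₂ u₂) (hR₁ : MemLp R₁ 2 volume) (hR₂ : MemLp R₂ 2 volume)
    (hI₁ : MemLp I₁ 2 volume) (hI₂ : MemLp I₂ 2 volume)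
    (hR : ∀ᵐ x, |R₁ x - R₂ x| ≤ g x) (hI : ∀ᵐ x, |I₁ x - I₂ x| ≤ g x) :
    MemLp (fun x => u₁ x - u₂ x) 2 volume ∧
      eLpNorm (fun x => u₁ x - u₂ x) 2 volume ≤ 3 * eLpNorm g 2 volume := by
  obtain ⟨v₁, hv₁, hu₁⟩ := h₁.exists_fun
  obtain ⟨v₂, hv₂, hu₂⟩ := h₂.exists_fun
  have hv : ∀ᵐ x, HasPVIntegral (fun ζ => I₁ ζ - I₂ ζ) x (v₁ x - v₂ x) := by
    filter_upwards [hv₁, hv₂] with x h1 h2 using h1.sub h2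
  obtain ⟨hvL, hvle⟩ := memLp_and_eLpNorm_le_of_hasPVIntegral (hI₁.sub hI₂) hv
  have hRL : MemLp (fun x => R₁ x - R₂ x) 2 volume := hR₁.sub hR₂
  have hu : (fun x => u₁ x - u₂ x) =ᵐ[volume]
      (-(fun x => R₁ x - R₂ x)) + ((-(1 / Real.pi)) • fun x => v₁ x - v₂ x) := by
    filter_upwards [hu₁, hu₂] with x h1 h2
    simp only [Pi.add_apply, Pi.neg_apply, Pi.smul_apply, smul_eq_mul, h1, h2]
    ring
  have hL := hRL.neg.add (hvL.const_smul (-(1 / Real.pi)))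
  refine ⟨hL.ae_eq hu.symm, ?_⟩
  rw [eLpNorm_congr_ae hu]
  refine (eLpNorm_add_le hRL.neg.aestronglyMeasurable
    (hvL.const_smul _).aestronglyMeasurable (by norm_num)).trans ?_
  rw [eLpNorm_neg, eLpNorm_const_smul]
  have e1 : eLpNorm (fun x => R₁ x - R₂ x) 2 volume ≤ eLpNorm g 2 volume :=
    eLpNorm_mono_ae_real hR
  have e2 : eLpNorm (fun x => I₁ x - I₂ x) 2 volume ≤ eLpNorm g 2 volume :=
    eLpNorm_mono_ae_real hI
  -- The norm 2π divided by π is 2; with the term `R` itself this makes the constant 3.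
  have e3 : ‖-(1 / Real.pi)‖ₑ * ENNReal.ofReal (2 * Real.pi) = 2 := by
    rw [Real.enorm_eq_ofReal_abs, abs_neg, abs_of_pos (by positivity),
      ← ENNReal.ofReal_mul (by positivity)]
    have : 1 / Real.pi * (2 * Real.pi) = 2 := by field_simp
    rw [this]; simp
  calc eLpNorm (fun x => R₁ x - R₂ x) 2 volume
        + ‖-(1 / Real.pi)‖ₑ * eLpNorm (fun x => v₁ x - v₂ x) 2 volume
      ≤ eLpNorm g 2 volume
        + ‖-(1 / Real.pi)‖ₑ * (ENNReal.ofReal (2 * Real.pi) * eLpNorm g 2 volume) := by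
        gcongr
        exact hvle.trans (by gcongr; exact e2)
    _ = 3 * eLpNorm g 2 volume := by
        rw [← mul_assoc, e3]; ring

theorem IsRieszSum.memLp {R I u : ℝ → ℝ} (h : IsRieszSum R I u) (hR : MemLp R 2 volume)
    (hI : MemLp I 2 volume) : MemLp u 2 volume := by
  have := (h.eLpNorm_sub_le (g := fun x => |R x| + |I x|) IsRieszSum.zero hR MemLp.zero' hI
    MemLp.zero' (ae_of_all _ fun x => by simp) (ae_of_all _ fun x => by simp)).1
  simpa using this

/-! ### Convergence of principal values for 1/2-Hölder functions. -/

theorem integrable_indicator_sqrt_mul_inv :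
    Integrable ((Set.Icc (-1 : ℝ) 1).indicator fun u => √|u| * |u|⁻¹) := by
  have h1 : Integrable ((Set.Ioc (0 : ℝ) 1).indicator fun u : ℝ => √|u| * |u|⁻¹) := by
    rw [integrable_indicator_iff measurableSet_Ioc]
    have h := (intervalIntegral.intervalIntegrable_rpow' (a := 0) (b := 1) (r := -(1 / 2))
      (by norm_num)).1
    refine h.congr_fun (fun u hu => ?_) measurableSet_Ioc
    simp only
    have hu0 : 0 < u := hu.1
    rw [abs_of_pos hu0, Real.rpow_neg hu0.le, ← Real.sqrt_eq_rpow]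
    have hs := Real.sqrt_pos.2 hu0
    have : u⁻¹ = (√u)⁻¹ * (√u)⁻¹ := by rw [← mul_inv, Real.mul_self_sqrt hu0.le]
    rw [this]
    field_simp
  refine (h1.add h1.comp_neg).congr ?_
  filter_upwards [Measure.ae_ne volume (0 : ℝ)] with u hu
  simp only [Pi.add_apply, Set.indicator_apply, Set.mem_Ioc, Set.mem_Icc, abs_neg]
  rcases lt_or_gt_of_ne hu with h | h
  · rw [if_neg (by intro h'; linarith [h'.1])]
    by_cases h2 : -1 ≤ u
    · rw [if_pos (by constructor <;> linarith), if_pos (by constructor <;> linarith), zero_add]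
    · rw [if_neg (by intro h'; linarith [h'.2]), if_neg (fun h' => h2 h'.1), zero_add]
  · rw [if_neg (by intro h'; linarith [h'.1] : ¬(0 < -u ∧ -u ≤ 1))]
    by_cases h2 : u ≤ 1
    · rw [if_pos (by constructor <;> linarith), if_pos (by constructor <;> linarith), add_zero]
    · rw [if_neg (fun h' => h2 h'.2), if_neg (fun h' => h2 h'.2), add_zero]

theorem integral_eq_zero_of_odd {k : ℝ → ℝ} (hk : ∀ u, k (-u) = -k u) : ∫ u, k u = 0 := by
  have h := integral_neg_eq_self k volume
  simp_rw [hk, integral_neg] at h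
  linarith

/-- The regularized integrand of a principal value integral. -/
noncomputable def pvIntegrand (f : ℝ → ℝ) (x ζ : ℝ) : ℝ :=
  (f ζ - (Set.Icc (-1 : ℝ) 1).indicator (fun _ => f x) (ζ - x)) * (ζ - x)⁻¹

theorem integrable_pvIntegrand {f : ℝ → ℝ} {x K : ℝ} (hf : MemLp f 2 volume)
    (hK : ∀ ζ, |ζ - x| ≤ 1 → |f ζ - f x| ≤ K * √|ζ - x|) : Integrable (pvIntegrand f x) := by
  have h1 := (integrable_indicator_sqrt_mul_inv.comp_sub_right x).const_mul K
  have h2 := (integrable_mul_translate hf (memLp_truncKernel one_pos) x).norm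
  refine (h1.add h2).mono' ?_ (ae_of_all _ fun ζ => ?_)
  · refine (hf.aestronglyMeasurable.sub ?_).mul ?_
    · exact ((measurable_const.indicator measurableSet_Icc).comp
        (measurable_id.sub_const x)).aestronglyMeasurable
    · exact (measurable_id.sub_const x).inv.aestronglyMeasurable
  · simp only [pvIntegrand, Pi.add_apply, norm_mul, Real.norm_eq_abs, truncKernel]
    by_cases h : |ζ - x| ≤ 1
    · have hm : ζ - x ∈ Set.Icc (-1 : ℝ) 1 := Set.mem_Icc.2 (abs_le.1 h)
      rw [Set.indicator_of_mem hm, Set.indicator_of_mem hm, if_neg (not_lt.2 h), abs_zero,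
        mul_zero, add_zero, abs_inv, ← mul_assoc]
      exact mul_le_mul_of_nonneg_right (hK ζ h) (by positivity)
    · have hm : ζ - x ∉ Set.Icc (-1 : ℝ) 1 := fun h' => h (abs_le.2 (Set.mem_Icc.1 h'))
      rw [Set.indicator_of_notMem hm, Set.indicator_of_notMem hm, if_pos (not_le.1 h), sub_zero,
        mul_zero, zero_add]

/-- Any odd regularization of the Cauchy kernel gives the same principal value. -/
theorem tendsto_integral_odd_kernel {f : ℝ → ℝ} {x K : ℝ} (hf : MemLp f 2 volume)
    (hK : ∀ ζ, |ζ - x| ≤ 1 → |f ζ - f x| ≤ K * √|ζ - x|) {k : ℝ → ℝ → ℝ}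
    (hk2 : ∀ ε, 0 < ε → MemLp (k ε) 2 volume) (hodd : ∀ ε u, k ε (-u) = -k ε u)
    (hle : ∀ ε u, |k ε u| ≤ |u|⁻¹)
    (hlim : ∀ u, u ≠ 0 → Tendsto (fun ε => k ε u) (𝓝[>] 0) (𝓝 u⁻¹)) :
    Tendsto (fun ε => ∫ ζ, f ζ * k ε (ζ - x)) (𝓝[>] 0) (𝓝 (∫ ζ, pvIntegrand f x ζ)) := by
  set c : ℝ → ℝ := (Set.Icc (-1 : ℝ) 1).indicator fun _ => f x with hc
  have hcL : MemLp c 2 volume := memLp_indicator_const 2 measurableSet_Icc _ (Or.inr (by simp))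
  have hcLx : MemLp (fun ζ => c (ζ - x)) 2 volume :=
    hcL.comp_measurePreserving (measurePreserving_sub_right volume x)
  have hceven : ∀ u, c (-u) = c u := fun u => by
    simp only [hc, Set.indicator_apply, Set.mem_Icc]
    congr 1
    exact propext ⟨fun h => ⟨by linarith [h.2], by linarith [h.1]⟩,
      fun h => ⟨by linarith [h.2], by linarith [h.1]⟩⟩
  -- The subtracted plateau is even about `x` and the kernel odd, so it does not change the
  -- integral; it makes the integrand dominated uniformly in `ε`.
  have hkey : ∀ ε, 0 < ε → ∫ ζ, f ζ * k ε (ζ - x) = ∫ ζ, (f ζ - c (ζ - x)) * k ε (ζ - x) := by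
    intro ε hε
    have h0 : ∫ ζ, c (ζ - x) * k ε (ζ - x) = 0 := by
      rw [integral_sub_right_eq_self (fun u => c u * k ε u)]
      exact integral_eq_zero_of_odd fun u => by rw [hceven, hodd, mul_neg]
    simp_rw [sub_mul]
    rw [integral_sub (integrable_mul_translate hf (hk2 ε hε) x)
      (integrable_mul_translate hcLx (hk2 ε hε) x), h0, sub_zero]
  refine Tendsto.congr' (f₁ := fun ε => ∫ ζ, (f ζ - c (ζ - x)) * k ε (ζ - x)) ?_ ?_
  · filter_upwards [self_mem_nhdsWithin] with ε hε using (hkey ε hε).symm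
  refine tendsto_integral_filter_of_dominated_convergence (fun ζ => ‖pvIntegrand f x ζ‖) ?_ ?_
    (integrable_pvIntegrand hf hK).norm ?_
  · filter_upwards [self_mem_nhdsWithin] with ε hε
    exact (integrable_mul_translate (hf.sub hcLx) (hk2 ε hε) x).aestronglyMeasurable
  · refine Eventually.of_forall fun ε => ae_of_all _ fun ζ => ?_
    simp only [pvIntegrand, norm_mul, norm_inv, Real.norm_eq_abs]
    exact mul_le_mul_of_nonneg_left (hle ε _) (abs_nonneg _)
  · filter_upwards [Measure.ae_ne volume x] with ζ hζ
    exact (hlim _ (sub_ne_zero.2 hζ)).const_mul _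

theorem hasPVIntegral_of_holder {f : ℝ → ℝ} {x K : ℝ} (hf : MemLp f 2 volume)
    (hK : ∀ ζ, |ζ - x| ≤ 1 → |f ζ - f x| ≤ K * √|ζ - x|) :
    HasPVIntegral f x (∫ ζ, pvIntegrand f x ζ) := by
  rw [hasPVIntegral_iff hf]
  refine tendsto_integral_odd_kernel hf hK (fun ε hε => memLp_truncKernel hε) (fun ε u => ?_)
    abs_truncKernel_le fun u hu => ?_
  · simp only [truncKernel, abs_neg, inv_neg]
    split_ifs <;> simp
  · refine tendsto_const_nhds.congr' ?_
    have : Set.Iio |u| ∈ 𝓝[>] (0 : ℝ) := mem_nhdsWithin_of_mem_nhds (Iio_mem_nhds (abs_pos.2 hu))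
    filter_upwards [this] with ε hε
    rw [truncKernel, if_pos (Set.mem_Iio.1 hε)]

/-- The limit is the same as for sharp truncation. The smooth kernel is the one that arises from
Cauchy's theorem, so this transfers the Plemelj computation to the principal value. -/
theorem tendsto_integral_conjKernel_of_holder {f : ℝ → ℝ} {x K : ℝ} (hf : MemLp f 2 volume)
    (hK : ∀ ζ, |ζ - x| ≤ 1 → |f ζ - f x| ≤ K * √|ζ - x|) :
    Tendsto (fun ε => ∫ ζ, f ζ * conjKernel ε (ζ - x)) (𝓝[>] 0)
      (𝓝 (∫ ζ, pvIntegrand f x ζ)) := by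
  refine tendsto_integral_odd_kernel hf hK (fun ε hε => memLp_conjKernel hε) (fun ε u => ?_)
    abs_conjKernel_le fun u hu => ?_
  · simp only [conjKernel, neg_sq, neg_div]
  · have hc : ContinuousAt (fun ε : ℝ => conjKernel ε u) 0 := by
      unfold conjKernel
      refine continuousAt_const.div (by fun_prop) ?_
      positivity
    have h := hc.tendsto.mono_left (nhdsWithin_le_nhds (s := Set.Ioi 0))
    have e : conjKernel 0 u = u⁻¹ := by
      simp only [conjKernel]; field_simp; simp
    rwa [e] at h

/-! ### Functions with L²-Lipschitz translates. -/

/-- `w` is Lipschitz with constant `M` as a map from translations to `L²`. -/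
def IsL2Lipschitz (M : ℝ) (w : ℝ → ℝ) : Prop :=
  ∀ h, eLpNorm (fun x => w (x + h) - w x) 2 volume ≤ ENNReal.ofReal (M * |h|)

theorem IsL2Lipschitz.congr_ae {M : ℝ} {w w' : ℝ → ℝ} (h : IsL2Lipschitz M w)
    (hw : w =ᵐ[volume] w') : IsL2Lipschitz M w' := fun c => by
  have h1 := (measurePreserving_add_right (volume : Measure ℝ) c).quasiMeasurePreserving.ae hw
  refine le_of_eq_of_le (eLpNorm_congr_ae ?_) (h c)
  filter_upwards [hw, h1] with x e1 e2
  rw [e1, e2]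

/-- Cauchy–Schwarz on an interval. -/
theorem abs_intervalIntegral_le_sqrt_mul {g : ℝ → ℝ} (hg : AEStronglyMeasurable g volume)
    {s A : ℝ} (hs : 0 ≤ s) (hA : 0 ≤ A) (h : eLpNorm g 2 volume ≤ ENNReal.ofReal A) :
    |∫ u in (0 : ℝ)..s, g u| ≤ √s * A := by
  have h1 : ENNReal.ofReal (|∫ u in (0 : ℝ)..s, g u|) ^ 2 ≤ ENNReal.ofReal (√s * A) ^ 2 := by
    rw [intervalIntegral.integral_of_le hs, ← Real.enorm_eq_ofReal_abs]
    calc ‖∫ u in Set.Ioc 0 s, g u‖ₑ ^ 2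
        ≤ (∫⁻ u in Set.Ioc 0 s, ‖g u‖ₑ) ^ 2 := by
          gcongr; exact enorm_integral_le_lintegral_enorm _
      _ ≤ (volume.restrict (Set.Ioc 0 s)) Set.univ * ∫⁻ u in Set.Ioc 0 s, ‖g u‖ₑ ^ 2 :=
          lintegral_sq_le _ hg.enorm.restrict
      _ ≤ ENNReal.ofReal s * ∫⁻ u, ‖g u‖ₑ ^ 2 := by
          gcongr
          · simp
          · exact Measure.restrict_le_self
      _ ≤ ENNReal.ofReal s * ENNReal.ofReal A ^ 2 := by
          rw [← eLpNorm_two_sq]; gcongr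
      _ = ENNReal.ofReal (√s * A) ^ 2 := by
          rw [← ENNReal.ofReal_pow hA, ← ENNReal.ofReal_mul hs,
            ← ENNReal.ofReal_pow (by positivity), mul_pow, Real.sq_sqrt hs]
  rw [ENNReal.pow_le_pow_left_iff two_ne_zero] at h1
  exact (ENNReal.ofReal_le_ofReal_iff (by positivity)).1 h1

/-- The average of `w` over `[x, x + r]`. -/
noncomputable def intervalAvg (w : ℝ → ℝ) (r x : ℝ) : ℝ := r⁻¹ * ∫ u in (0 : ℝ)..r, w (x + u)

theorem intervalIntegrable_of_memLp_two {w : ℝ → ℝ} (hw : MemLp w 2 volume) (a b : ℝ) :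
    IntervalIntegrable w volume a b :=
  ((hw.locallyIntegrable (by norm_num)).integrableOn_isCompact isCompact_uIcc).intervalIntegrable

/-- The second half of `[x, x + r]` is the first half shifted by `r/2`, so the difference of
averages is `1/r` times an integral of a translate difference, and Cauchy–Schwarz applies. -/
theorem abs_intervalAvg_sub_half_le {w : ℝ → ℝ} {M r : ℝ} (hw : MemLp w 2 volume)
    (hM : 0 ≤ M) (hL : IsL2Lipschitz M w) (hr : 0 < r) (x : ℝ) :
    |intervalAvg w r x - intervalAvg w (r / 2) x| ≤ M / 2 * √r := by
  have hwx : MemLp (fun u => w (x + u)) 2 volume :=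
    hw.comp_measurePreserving (measurePreserving_add_left volume x)
  have hwx' : MemLp (fun u => w (x + (u + r / 2))) 2 volume :=
    hwx.comp_measurePreserving (measurePreserving_add_right volume (r / 2))
  have e : intervalAvg w r x - intervalAvg w (r / 2) x
      = r⁻¹ * ∫ u in (0 : ℝ)..r / 2, (w (x + (u + r / 2)) - w (x + u)) := by
    rw [intervalIntegral.integral_sub (intervalIntegrable_of_memLp_two hwx' _ _)
      (intervalIntegrable_of_memLp_two hwx _ _),
      intervalIntegral.integral_comp_add_right (fun u => w (x + u)), zero_add, add_halves]
    simp only [intervalAvg]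
    rw [← intervalIntegral.integral_add_adjacent_intervals
      (intervalIntegrable_of_memLp_two hwx 0 (r / 2))
      (intervalIntegrable_of_memLp_two hwx (r / 2) r)]
    field_simp
    ring
  have h0 : eLpNorm (fun u => w (x + (u + r / 2)) - w (x + u)) 2 volume
      ≤ ENNReal.ofReal (M * (r / 2)) := by
    have h1 := hL (r / 2)
    rw [abs_of_pos (by positivity)] at h1
    refine le_of_eq_of_le ?_ h1
    have h2 : MemLp (fun y => w (y + r / 2) - w y) 2 volume :=
      (hw.comp_measurePreserving (measurePreserving_add_right volume (r / 2))).sub hw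
    rw [← eLpNorm_comp_measurePreserving h2.aestronglyMeasurable
      (measurePreserving_add_left volume x)]
    congr with u
    simp [add_assoc]
  have h1 := abs_intervalIntegral_le_sqrt_mul (hwx'.sub hwx).aestronglyMeasurable
    (s := r / 2) (by positivity) (by positivity) h0
  rw [e, abs_mul, abs_of_pos (inv_pos.2 hr)]
  calc r⁻¹ * |∫ u in (0 : ℝ)..r / 2, (w (x + (u + r / 2)) - w (x + u))|
      ≤ r⁻¹ * (√(r / 2) * (M * (r / 2))) := by gcongr; exact h1
    _ = M / 2 * √(r / 2) := by field_simp
    _ ≤ M / 2 * √r := by gcongr; linarith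

/-- The number 3/4 is a rational upper bound for `1/√2`, convenient as a geometric ratio. -/
theorem sqrt_div_two_pow_le {r : ℝ} (hr : 0 < r) (n : ℕ) : √(r / 2 ^ n) ≤ √r * (3 / 4) ^ n := by
  rw [Real.sqrt_le_left (by positivity), mul_pow, Real.sq_sqrt hr.le, div_eq_mul_inv, ← pow_mul,
    mul_comm n 2, pow_mul, ← inv_pow]
  gcongr
  norm_num

theorem dist_intervalAvg_le {w : ℝ → ℝ} {M r : ℝ} (hw : MemLp w 2 volume)
    (hM : 0 ≤ M) (hL : IsL2Lipschitz M w) (hr : 0 < r) (x : ℝ) (n : ℕ) :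
    dist (intervalAvg w (r / 2 ^ n) x) (intervalAvg w (r / 2 ^ (n + 1)) x)
      ≤ M / 2 * √r * (3 / 4) ^ n := by
  have h := abs_intervalAvg_sub_half_le hw hM hL (r := r / 2 ^ n) (by positivity) x
  rw [Real.dist_eq, pow_succ, ← div_div]
  refine h.trans ?_
  rw [mul_assoc]
  gcongr
  exact sqrt_div_two_pow_le hr n

theorem continuous_intervalAvg {w : ℝ → ℝ} (hw : MemLp w 2 volume) (r : ℝ) :
    Continuous (intervalAvg w r) := by
  have hp := intervalIntegral.continuous_primitive
    (fun a b => intervalIntegrable_of_memLp_two hw a b) 0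
  have e : intervalAvg w r
      = fun x => r⁻¹ * ((∫ u in (0 : ℝ)..x + r, w u) - ∫ u in (0 : ℝ)..x, w u) := by
    ext x
    rw [intervalAvg, intervalIntegral.integral_comp_add_left, add_zero,
      intervalIntegral.integral_interval_sub_left (intervalIntegrable_of_memLp_two hw _ _)
        (intervalIntegrable_of_memLp_two hw _ _)]
  rw [e]
  exact continuous_const.mul ((hp.comp (by fun_prop)).sub hp)

theorem tendsto_intervalAvg_of_hasDerivAt {w : ℝ → ℝ} (hw : MemLp w 2 volume) {x : ℝ}
    (hx : HasDerivAt (fun x => ∫ t in (0 : ℝ)..x, w t) (w x) x) {r : ℕ → ℝ}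
    (hr : ∀ n, 0 < r n) (hr0 : Tendsto r atTop (𝓝 0)) :
    Tendsto (fun n => intervalAvg w (r n) x) atTop (𝓝 (w x)) := by
  have h1 := hasDerivAt_iff_tendsto_slope_zero.1 hx
  have h2 : Tendsto r atTop (𝓝[≠] 0) :=
    tendsto_nhdsWithin_iff.2 ⟨hr0, Eventually.of_forall fun n => (hr n).ne'⟩
  refine (h1.comp h2).congr fun n => ?_
  simp only [Function.comp, smul_eq_mul, intervalAvg]
  rw [intervalIntegral.integral_comp_add_left, add_zero,
      intervalIntegral.integral_interval_sub_left (intervalIntegrable_of_memLp_two hw _ _)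
        (intervalIntegrable_of_memLp_two hw _ _)]

theorem tendsto_div_two_pow (r : ℝ) : Tendsto (fun n : ℕ => r / 2 ^ n) atTop (𝓝 0) :=
  tendsto_const_nhds.div_atTop (tendsto_pow_atTop_atTop_of_one_lt one_lt_two)

/-- A one-dimensional Sobolev embedding. -/
theorem exists_continuous_ae_eq_of_isL2Lipschitz {w : ℝ → ℝ} {M : ℝ} (hw : MemLp w 2 volume)
    (hM : 0 ≤ M) (hL : IsL2Lipschitz M w) : ∃ W : ℝ → ℝ, Continuous W ∧ w =ᵐ[volume] W := by
  have hd := fun x n => dist_intervalAvg_le hw hM hL one_pos x n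
  have hc := fun x => cauchySeq_of_le_geometric _ _ (by norm_num) (hd x)
  choose W hW using fun x => cauchySeq_tendsto_of_complete (hc x)
  have hWn := fun x => dist_le_of_le_geometric_of_tendsto _ _ (by norm_num) (hd x) (hW x)
  refine ⟨W, ?_, ?_⟩
  · have hu : TendstoUniformly (fun (n : ℕ) x => intervalAvg w (1 / 2 ^ n) x) W atTop := by
      rw [Metric.tendstoUniformly_iff]
      intro e he
      have h0 : Tendsto (fun n : ℕ => M / 2 * √1 * (3 / 4 : ℝ) ^ n / (1 - 3 / 4)) atTop (𝓝 0) := by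
        have := ((tendsto_pow_atTop_nhds_zero_of_lt_one (r := (3 / 4 : ℝ)) (by norm_num)
          (by norm_num)).const_mul (M / 2 * √1)).div_const (1 - 3 / 4)
        simpa using this
      filter_upwards [h0.eventually_lt_const he] with n hn x
      rw [dist_comm]
      exact (hWn x n).trans_lt hn
    exact hu.continuous (Frequently.of_forall fun n => continuous_intervalAvg hw _)
  · filter_upwards [LocallyIntegrable.ae_hasDerivAt_integral
      (hw.locallyIntegrable (by norm_num))] with x hx
    exact tendsto_nhds_unique (tendsto_intervalAvg_of_hasDerivAt hw (hx 0)
      (fun n => by positivity) (tendsto_div_two_pow 1)) (hW x)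

/-- The average over length `r` is at most `A/√r` by Cauchy–Schwarz, and the dyadic averages
telescope to `w x` with total error `(M/2)√r / (1 - 3/4) = 2M√r`. The scale `r` stays free, to be
optimized in the asymptotics. -/
theorem abs_le_of_isL2Lipschitz {w : ℝ → ℝ} {M A r : ℝ} (hw : MemLp w 2 volume)
    (hc : Continuous w) (hM : 0 ≤ M) (hL : IsL2Lipschitz M w) (hA : 0 ≤ A)
    (hwA : eLpNorm w 2 volume ≤ ENNReal.ofReal A) (hr : 0 < r) (x : ℝ) :
    |w x| ≤ A / √r + 2 * M * √r := by
  have hd := fun n => dist_intervalAvg_le hw hM hL hr x n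
  have ht := tendsto_intervalAvg_of_hasDerivAt hw (hc.integral_hasStrictDerivAt 0 x).hasDerivAt
    (r := fun n => r / 2 ^ n) (fun n => by positivity) (tendsto_div_two_pow r)
  have h1 := dist_le_of_le_geometric_of_tendsto₀ _ _ (by norm_num) hd ht
  have hwx : MemLp (fun u => w (x + u)) 2 volume :=
    hw.comp_measurePreserving (measurePreserving_add_left volume x)
  have h2 := abs_intervalIntegral_le_sqrt_mul hwx.aestronglyMeasurable hr.le hA
    ((eLpNorm_comp_measurePreserving hw.aestronglyMeasurable
      (measurePreserving_add_left volume x)).trans_le hwA)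
  have h3 : |intervalAvg w r x| ≤ A / √r := by
    rw [intervalAvg, abs_mul, abs_of_pos (inv_pos.2 hr)]
    calc r⁻¹ * |∫ u in (0 : ℝ)..r, w (x + u)| ≤ r⁻¹ * (√r * A) := by gcongr
      _ = A / √r := by
        have hs := Real.sqrt_pos.2 hr
        have : r⁻¹ = (√r)⁻¹ * (√r)⁻¹ := by rw [← mul_inv, Real.mul_self_sqrt hr.le]
        rw [this]; field_simp
  rw [Real.dist_eq, pow_zero, div_one] at h1
  have h4 : |w x| ≤ |intervalAvg w r x| + |intervalAvg w r x - w x| := by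
    have := abs_sub (intervalAvg w r x) (intervalAvg w r x - w x)
    rwa [sub_sub_cancel] at this
  have h5 : M / 2 * √r / (1 - 3 / 4) = 2 * M * √r := by ring
  linarith

theorem IsL2Lipschitz.translate_sub {w : ℝ → ℝ} {M : ℝ} (hw : MemLp w 2 volume) (hM : 0 ≤ M)
    (hL : IsL2Lipschitz M w) (h : ℝ) : IsL2Lipschitz (2 * M) (fun x => w (x + h) - w x) := by
  intro c
  have h1 : MemLp (fun y => w (y + c) - w y) 2 volume :=
    (hw.comp_measurePreserving (measurePreserving_add_right volume c)).sub hw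
  have h2 : MemLp (fun y => w (y + h + c) - w (y + h)) 2 volume := by
    have := h1.comp_measurePreserving (measurePreserving_add_right volume h)
    exact this
  have e : (fun x => w (x + c + h) - w (x + c) - (w (x + h) - w x))
      = (fun y => w (y + h + c) - w (y + h)) - fun y => w (y + c) - w y := by
    ext x
    simp only [Pi.sub_apply, add_right_comm x c h]
    ring
  rw [e]
  refine (eLpNorm_sub_le h2.aestronglyMeasurable h1.aestronglyMeasurable (by norm_num)).trans ?_
  have e2 : eLpNorm (fun y => w (y + h + c) - w (y + h)) 2 volume
      = eLpNorm (fun y => w (y + c) - w y) 2 volume := by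
    rw [← eLpNorm_comp_measurePreserving h1.aestronglyMeasurable
      (measurePreserving_add_right volume h)]
    rfl
  rw [e2, mul_assoc, two_mul, ENNReal.ofReal_add (by positivity) (by positivity)]
  exact add_le_add (hL c) (hL c)

/-- The sup bound is applied to `w(· + h) - w` with `h = y - x`, whose norm is at most `M|h|` and
whose Lipschitz constant is `2M`. The scale `r = |h|` gives `1 + 4 = 5`. -/
theorem IsL2Lipschitz.holder {w : ℝ → ℝ} {M : ℝ} (hw : MemLp w 2 volume) (hc : Continuous w)
    (hM : 0 ≤ M) (hL : IsL2Lipschitz M w) (x y : ℝ) : |w y - w x| ≤ 5 * M * √|y - x| := by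
  rcases eq_or_ne y x with rfl | hne
  · simp
  have hpos : 0 < |y - x| := abs_pos.2 (sub_ne_zero.2 hne)
  have h1 : MemLp (fun z => w (z + (y - x)) - w z) 2 volume :=
    (hw.comp_measurePreserving (measurePreserving_add_right volume (y - x))).sub hw
  have h := abs_le_of_isL2Lipschitz h1 (by fun_prop) (by positivity : 0 ≤ 2 * M)
    (hL.translate_sub hw hM (y - x)) (by positivity) (hL (y - x)) hpos x
  simp only [add_sub_cancel] at h
  refine h.trans (le_of_eq ?_)
  have hs := Real.sqrt_pos.2 hpos
  have e : M * |y - x| / √|y - x| = M * √|y - x| := by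
    rw [mul_div_assoc, Real.div_sqrt]
  rw [e]; ring

/-! ### Uniqueness, translation estimates and one step of the iteration. -/

theorem tan_pi_div_eight_le_one : Real.tan (Real.pi / 8) ≤ 1 := by
  rw [← Real.tan_pi_div_four]
  have := Real.pi_pos
  exact (Real.tan_lt_tan_of_lt_of_lt_pi_div_two (by linarith) (by linarith) (by linarith)).le

theorem le_twelve_mul_of_le_three_mul {a b : ENNReal} (ha : a ≠ ⊤)
    (h : a ≤ 3 * (ENNReal.ofReal (1 / 4) * a + b)) : a ≤ 12 * b := by
  rcases eq_or_ne b ⊤ with rfl | hb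
  · simp
  lift a to NNReal using ha
  lift b to NNReal using hb
  have e : ENNReal.ofReal (1 / 4) = ((1 / 4 : NNReal) : ENNReal) := by
    rw [ENNReal.ofReal, ENNReal.coe_inj]
    ext; simp
  rw [e] at h
  have h' : a ≤ 3 * (1 / 4 * a + b) := by exact_mod_cast h
  have : a ≤ 12 * b := by
    rw [← NNReal.coe_le_coe] at h' ⊢
    push_cast at h' ⊢
    linarith
  exact_mod_cast this

section

variable {χ : ℝ → ℝ → ℂ}

theorem hasDerivAt_dXi (hs : SolvabilityConditions χ) (ξ lam : ℝ) :
    HasDerivAt (fun s => χ s lam) (dXi χ ξ lam) ξ := (hs.differentiable_xi lam ξ).hasDerivAt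

theorem hasDerivAt_dLam (hj : JostConditions χ) (ξ lam : ℝ) :
    HasDerivAt (fun s => χ ξ s) (dLam χ ξ lam) lam := (hj.differentiable_lam ξ lam).hasDerivAt

theorem abs_re_sub_le (hs : SolvabilityConditions χ) (a b lam : ℝ) :
    |(χ a lam).re - (χ b lam).re| ≤ 1 / 4 * |a - b| := by
  have h := Convex.norm_image_sub_le_of_norm_hasDerivWithin_le (s := Set.univ) (C := 1 / 4)
    (f := fun s => (χ s lam).re) (f' := fun s => (dXi χ s lam).re) (x := b) (y := a)
    (fun s _ => ((Complex.reCLM.hasFDerivAt.comp_hasDerivAt s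
      (hasDerivAt_dXi hs s lam)).hasDerivWithinAt))
    (fun s _ => (hs.dXi_re_le s lam).trans (by linarith [tan_pi_div_eight_le_one]))
    convex_univ (Set.mem_univ _) (Set.mem_univ _)
  exact h

theorem abs_im_sub_le (hs : SolvabilityConditions χ) (a b lam : ℝ) :
    |(χ a lam).im - (χ b lam).im| ≤ 1 / 4 * |a - b| := by
  have h := Convex.norm_image_sub_le_of_norm_hasDerivWithin_le (s := Set.univ) (C := 1 / 4)
    (f := fun s => (χ s lam).im) (f' := fun s => (dXi χ s lam).im) (x := b) (y := a)
    (fun s _ => ((Complex.imCLM.hasFDerivAt.comp_hasDerivAt s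
      (hasDerivAt_dXi hs s lam)).hasDerivWithinAt))
    (fun s _ => (hs.dXi_im_le s lam).trans (by linarith [tan_pi_div_eight_le_one]))
    convex_univ (Set.mem_univ _) (Set.mem_univ _)
  exact h

theorem hasDerivAt_along_curve (hs : SolvabilityConditions χ) (hj : JostConditions χ)
    {φ : ℝ → ℝ} {φ' μ : ℝ} (hφ : HasDerivAt φ φ' μ) :
    HasDerivAt (fun s => χ (φ s) s) (φ' • dXi χ (φ μ) μ + dLam χ (φ μ) μ) μ := by
  have h := hasStrictFDerivAt_uncurry_coprod (𝕜 := ℝ) (u := (φ μ, μ)) (f := χ)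
    (f₁ := fun ξ l => ContinuousLinearMap.toSpanSingleton ℝ (dXi χ ξ l))
    (f₂ := fun ξ l => ContinuousLinearMap.toSpanSingleton ℝ (dLam χ ξ l))
    (Eventually.of_forall fun v => (hasDerivAt_dXi hs v.1 v.2).hasFDerivAt)
    (Eventually.of_forall fun v => (hasDerivAt_dLam hj v.1 v.2).hasFDerivAt)
    ((ContinuousLinearMap.toSpanSingletonCLE (𝕜 := ℝ) (E := ℂ)).continuous.comp
      hs.continuous_dXi).continuousAt
    ((ContinuousLinearMap.toSpanSingletonCLE (𝕜 := ℝ) (E := ℂ)).continuous.comp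
      hj.continuous_dLam).continuousAt
  have h2 := HasFDerivAt.comp_hasDerivAt (f := fun s => (φ s, s)) μ h.hasFDerivAt
    (hφ.prodMk (hasDerivAt_id μ))
  refine h2.congr_deriv ?_
  simp [Function.HasUncurry.uncurry]

/-- The fundamental theorem of calculus along the segment, in the form of an average of translates
by `hθ`, which is what `eLpNorm_translates_le` bounds. -/
theorem enorm_sub_le_lintegral_translates {F F' : ℝ → ℂ} {b : ℝ → ℝ}
    (hF : ∀ μ, HasDerivAt F (F' μ) μ)
    (hF' : Continuous F') (hb : ∀ μ, ‖F' μ‖ ≤ b μ) (l h : ℝ) :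
    ‖F (l + h) - F l‖ₑ ≤ ∫⁻ θ in Set.Ioc (0 : ℝ) 1, ‖h * b (l + h * θ)‖ₑ := by
  have hd : ∀ θ ∈ Set.uIcc (0 : ℝ) 1,
      HasDerivAt (fun θ => F (l + h * θ)) (h • F' (l + h * θ)) θ := fun θ _ =>
    (hF (l + h * θ)).scomp θ (by simpa using ((hasDerivAt_id θ).const_mul h).const_add l)
  have hi : IntervalIntegrable (fun θ => h • F' (l + h * θ)) volume 0 1 :=
    Continuous.intervalIntegrable (by fun_prop) _ _
  have e := intervalIntegral.integral_eq_sub_of_hasDerivAt hd hi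
  simp only [mul_one, mul_zero, add_zero] at e
  rw [← e, intervalIntegral.integral_of_le zero_le_one]
  refine (enorm_integral_le_lintegral_enorm _).trans (lintegral_mono fun θ => ?_)
  rw [enorm_smul, enorm_mul]
  gcongr
  rw [← ofReal_norm, ← ofReal_norm]
  exact ENNReal.ofReal_le_ofReal ((hb _).trans (Real.le_norm_self _))

/-- The real part of the spectral data along `ψ`. -/
noncomputable def reData (χ : ℝ → ℝ → ℂ) (x y t : ℝ) (ω : ℝ → ℝ) (lam : ℝ) : ℝ :=
  (χ (psi x y t ω lam) lam).re

/-- The imaginary part of the spectral data along `ψ`. -/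
noncomputable def imData (χ : ℝ → ℝ → ℂ) (x y t : ℝ) (ω : ℝ → ℝ) (lam : ℝ) : ℝ :=
  (χ (psi x y t ω lam) lam).im

theorem psi_add (x y t : ℝ) (ω : ℝ → ℝ) (lam : ℝ) :
    psi x y t ω lam = x - lam * y - lam ^ 2 * t + ω lam := rfl

theorem isInverseSolution_iff {x y t : ℝ} {ω : ℝ → ℝ} :
    IsInverseSolution χ x y t ω ↔
      MemLp ω 2 volume ∧ IsRieszSum (reData χ x y t ω) (imData χ x y t ω) ω := by
  unfold IsInverseSolution IsRieszSum
  refine and_congr_right fun _ => ?_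
  refine eventually_congr (ae_of_all _ fun lam => exists_congr fun v => and_congr_right fun _ => ?_)
  simp only [reData, psi_add]
  constructor <;> intro h <;> linarith

theorem memLp_data {φ : ℝ → ℝ} (hs : SolvabilityConditions χ) (hφ : AEStronglyMeasurable φ volume) :
    MemLp (fun l => χ (φ l) l) 2 volume := by
  obtain ⟨C, _, hC⟩ := hs.decay
  exact memLp_two_of_le (hs.continuous.comp_aestronglyMeasurable
    (hφ.prodMk aestronglyMeasurable_id)) fun l => hC _ _

theorem aestronglyMeasurable_psi {x y t : ℝ} {ω : ℝ → ℝ} (hω : AEStronglyMeasurable ω volume) :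
    AEStronglyMeasurable (psi x y t ω) volume := by
  have h : Continuous fun lam : ℝ => x - lam * y - lam ^ 2 * t := by fun_prop
  exact h.aestronglyMeasurable.add hω

theorem memLp_reData {x y t : ℝ} {ω : ℝ → ℝ} (hs : SolvabilityConditions χ)
    (hω : AEStronglyMeasurable ω volume) : MemLp (reData χ x y t ω) 2 volume :=
  (memLp_data hs (aestronglyMeasurable_psi hω)).re

theorem memLp_imData {x y t : ℝ} {ω : ℝ → ℝ} (hs : SolvabilityConditions χ)
    (hω : AEStronglyMeasurable ω volume) : MemLp (imData χ x y t ω) 2 volume :=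
  (memLp_data hs (aestronglyMeasurable_psi hω)).im

theorem eLpNorm_sub_le_of_isRieszSum {x y t : ℝ} {ω₁ ω₂ u₁ u₂ : ℝ → ℝ}
    (hs : SolvabilityConditions χ) (h₁ : AEStronglyMeasurable ω₁ volume)
    (h₂ : AEStronglyMeasurable ω₂ volume)
    (hu₁ : IsRieszSum (reData χ x y t ω₁) (imData χ x y t ω₁) u₁)
    (hu₂ : IsRieszSum (reData χ x y t ω₂) (imData χ x y t ω₂) u₂) :
    eLpNorm (fun l => u₁ l - u₂ l) 2 volume
      ≤ 3 * (ENNReal.ofReal (1 / 4) * eLpNorm (fun l => ω₁ l - ω₂ l) 2 volume) := by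
  have h := (hu₁.eLpNorm_sub_le hu₂ (memLp_reData hs h₁) (memLp_reData hs h₂)
    (memLp_imData hs h₁) (memLp_imData hs h₂) (g := fun l => 1 / 4 * |ω₁ l - ω₂ l|)
    (ae_of_all _ fun l => (abs_re_sub_le hs _ _ l).trans_eq (by simp [psi_add]))
    (ae_of_all _ fun l => (abs_im_sub_le hs _ _ l).trans_eq (by simp [psi_add]))).2
  refine h.trans_eq ?_
  have e : (fun l => 1 / 4 * |ω₁ l - ω₂ l|) = (1 / 4 : ℝ) • fun l => ‖ω₁ l - ω₂ l‖ := by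
    ext l; simp
  rw [e, eLpNorm_const_smul, eLpNorm_norm, Real.enorm_of_nonneg (by norm_num)]

theorem ae_eq_of_isInverseSolution {x y t : ℝ} {ω₁ ω₂ : ℝ → ℝ} (hs : SolvabilityConditions χ)
    (h₁ : IsInverseSolution χ x y t ω₁) (h₂ : IsInverseSolution χ x y t ω₂) :
    ω₁ =ᵐ[volume] ω₂ := by
  rw [isInverseSolution_iff] at h₁ h₂
  have h := eLpNorm_sub_le_of_isRieszSum hs h₁.1.aestronglyMeasurable h₂.1.aestronglyMeasurable
    h₁.2 h₂.2
  have h0 := le_twelve_mul_of_le_three_mul (b := 0) (h₁.1.sub h₂.1).2.ne (by rw [add_zero]; exact h)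
  rw [mul_zero, nonpos_iff_eq_zero, eLpNorm_eq_zero_iff (h₁.1.sub h₂.1).aestronglyMeasurable
    (by norm_num)] at h0
  filter_upwards [h0] with l hl
  exact sub_eq_zero.1 hl

/-- The derivative in `μ` of the data along `x - μ y - μ² t + a`. -/
noncomputable def curveDeriv (χ : ℝ → ℝ → ℂ) (x y t a μ : ℝ) : ℂ :=
  (-y - 2 * μ * t) • dXi χ (x - μ * y - μ ^ 2 * t + a) μ + dLam χ (x - μ * y - μ ^ 2 * t + a) μ

theorem hasDerivAt_curve (hs : SolvabilityConditions χ) (hj : JostConditions χ) (x y t a μ : ℝ) :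
    HasDerivAt (fun μ => χ (x - μ * y - μ ^ 2 * t + a) μ) (curveDeriv χ x y t a μ) μ := by
  refine hasDerivAt_along_curve hs hj (φ := fun μ => x - μ * y - μ ^ 2 * t + a) ?_
  have h := ((((hasDerivAt_id μ).mul_const y).const_sub x).sub
    (((hasDerivAt_id μ).pow 2).mul_const t)).add_const a
  refine h.congr_deriv ?_
  simp

theorem continuous_curveDeriv (hs : SolvabilityConditions χ) (hj : JostConditions χ)
    (x y t a : ℝ) : Continuous (curveDeriv χ x y t a) := by
  have h1 : Continuous fun μ => dXi χ (x - μ * y - μ ^ 2 * t + a) μ :=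
    hs.continuous_dXi.comp (f := fun μ : ℝ => (x - μ * y - μ ^ 2 * t + a, μ)) (by fun_prop)
  have h2 : Continuous fun μ => dLam χ (x - μ * y - μ ^ 2 * t + a) μ :=
    hj.continuous_dLam.comp (f := fun μ : ℝ => (x - μ * y - μ ^ 2 * t + a, μ)) (by fun_prop)
  unfold curveDeriv
  fun_prop

/-- Translation estimate for one step of the iteration. -/
theorem eLpNorm_translate_sub_le {x y t : ℝ} {ω u b : ℝ → ℝ}
    (hs : SolvabilityConditions χ) (hj : JostConditions χ) (hω : AEStronglyMeasurable ω volume)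
    (hu : IsRieszSum (reData χ x y t ω) (imData χ x y t ω) u) (hbc : Continuous b)
    (hb : ∀ l μ, ‖curveDeriv χ x y t (ω l) μ‖ ≤ b μ) (h : ℝ) :
    eLpNorm (fun l => u (l + h) - u l) 2 volume
      ≤ 3 * (ENNReal.ofReal (1 / 4) * eLpNorm (fun l => ω (l + h) - ω l) 2 volume
        + ENNReal.ofReal |h| * eLpNorm b 2 volume) := by
  have hmp := measurePreserving_add_right (volume : Measure ℝ) h
  have hωh : AEStronglyMeasurable (fun l => ω (l + h)) volume := hω.comp_measurePreserving hmp
  set p : ℝ → ℝ := fun μ => x - μ * y - μ ^ 2 * t with hp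
  have hpc : Continuous p := by fun_prop
  -- The increment of the data is split in two. Changing `ω(l)` to `ω(l + h)` costs a factor 1/4;
  -- moving along the explicit curve with `ω` frozen at `ω(l)` gives `G`, controlled by
  -- `curveDeriv`.
  set G : ℝ → ℂ := fun l => χ (p (l + h) + ω l) (l + h) - χ (p l + ω l) l with hG
  have hGm : AEStronglyMeasurable G volume := by
    refine (hs.continuous.comp_aestronglyMeasurable (AEStronglyMeasurable.prodMk ?_ ?_)).sub
      (hs.continuous.comp_aestronglyMeasurable (AEStronglyMeasurable.prodMk ?_ ?_))
    · exact (hpc.comp (by fun_prop)).aestronglyMeasurable.add hω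
    · exact Continuous.aestronglyMeasurable (by fun_prop)
    · exact hpc.aestronglyMeasurable.add hω
    · exact aestronglyMeasurable_id
  have hGle : eLpNorm G 2 volume ≤ ENNReal.ofReal |h| * eLpNorm b 2 volume := by
    have h1 := eLpNorm_translates_le (volume.restrict (Set.Ioc (0 : ℝ) 1)) h
      (g := fun z => h * b z) (G := G)
      (hbc.stronglyMeasurable.const_mul h)
      fun l => enorm_sub_le_lintegral_translates (hasDerivAt_curve hs hj x y t (ω l))
        (continuous_curveDeriv hs hj x y t (ω l)) (hb l) l h
    refine h1.trans_eq ?_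
    have e : (fun z => h * b z) = h • b := rfl
    rw [e, eLpNorm_const_smul, Real.enorm_eq_ofReal_abs]
    simp
  have hre : ∀ l, |reData χ x y t ω (l + h) - reData χ x y t ω l|
      ≤ 1 / 4 * |ω (l + h) - ω l| + ‖G l‖ := fun l => by
    have h1 := abs_re_sub_le hs (p (l + h) + ω (l + h)) (p (l + h) + ω l) (l + h)
    have h2 := Complex.abs_re_le_norm (G l)
    rw [add_sub_add_left_eq_sub] at h1
    simp only [hG, Complex.sub_re] at h2
    refine le_trans ?_ (add_le_add h1 h2)
    refine le_trans (le_of_eq ?_) (abs_add_le _ _)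
    simp only [reData, psi_add, hp]
    congr 1; ring
  have him : ∀ l, |imData χ x y t ω (l + h) - imData χ x y t ω l|
      ≤ 1 / 4 * |ω (l + h) - ω l| + ‖G l‖ := fun l => by
    have h1 := abs_im_sub_le hs (p (l + h) + ω (l + h)) (p (l + h) + ω l) (l + h)
    have h2 := Complex.abs_im_le_norm (G l)
    rw [add_sub_add_left_eq_sub] at h1
    simp only [hG, Complex.sub_im] at h2
    refine le_trans ?_ (add_le_add h1 h2)
    refine le_trans (le_of_eq ?_) (abs_add_le _ _)
    simp only [imData, psi_add, hp]
    congr 1; ring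
  have hm := ((hu.comp_add_right h).eLpNorm_sub_le hu
    ((memLp_reData hs hω).comp_measurePreserving hmp) (memLp_reData hs hω)
    ((memLp_imData hs hω).comp_measurePreserving hmp) (memLp_imData hs hω)
    (ae_of_all _ hre) (ae_of_all _ him)).2
  refine hm.trans ?_
  gcongr
  have e : (fun l => 1 / 4 * |ω (l + h) - ω l| + ‖G l‖)
      = ((1 / 4 : ℝ) • fun l => ‖ω (l + h) - ω l‖) + fun l => ‖G l‖ := by
    ext l; simp
  rw [e]
  refine (eLpNorm_add_le ((hωh.sub hω).norm.const_smul _) hGm.norm (by norm_num)).trans ?_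
  rw [eLpNorm_const_smul, eLpNorm_norm, eLpNorm_norm, Real.enorm_of_nonneg (by norm_num)]
  exact add_le_add le_rfl hGle

/-- A priori bound on translates of a solution. -/
theorem isL2Lipschitz_of_isInverseSolution {x y t B : ℝ} {ω b : ℝ → ℝ}
    (hs : SolvabilityConditions χ) (hj : JostConditions χ) (hω : IsInverseSolution χ x y t ω)
    (hbc : Continuous b) (hb : ∀ l μ, ‖curveDeriv χ x y t (ω l) μ‖ ≤ b μ)
    (hB : eLpNorm b 2 volume ≤ ENNReal.ofReal B) : IsL2Lipschitz (12 * B) ω := by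
  intro h
  rw [isInverseSolution_iff] at hω
  have h1 := eLpNorm_translate_sub_le hs hj hω.1.aestronglyMeasurable hω.2 hbc hb h
  have hL : MemLp (fun l => ω (l + h) - ω l) 2 volume :=
    (hω.1.comp_measurePreserving (measurePreserving_add_right volume h)).sub hω.1
  refine (le_twelve_mul_of_le_three_mul hL.2.ne h1).trans ?_
  calc 12 * (ENNReal.ofReal |h| * eLpNorm b 2 volume)
      ≤ 12 * (ENNReal.ofReal |h| * ENNReal.ofReal B) := by gcongr
    _ = ENNReal.ofReal (12 * B * |h|) := by
      rw [show 12 * B * |h| = 12 * (|h| * B) by ring, ENNReal.ofReal_mul (by norm_num),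
        ENNReal.ofReal_mul (abs_nonneg h)]
      norm_num

/-- One step of the iteration preserves the class of `L²`-Lipschitz functions. -/
theorem exists_isRieszSum_isL2Lipschitz {x y t B c : ℝ} {ω b : ℝ → ℝ}
    (hs : SolvabilityConditions χ) (hj : JostConditions χ) (hω : MemLp ω 2 volume) (hB0 : 0 ≤ B)
    (hL : IsL2Lipschitz (12 * B) ω) (hbc : Continuous b)
    (hb : ∀ a μ, ‖curveDeriv χ x y t a μ‖ ≤ b μ) (hbb : ∀ μ, b μ ≤ c)
    (hB : eLpNorm b 2 volume ≤ ENNReal.ofReal B) :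
    ∃ u, MemLp u 2 volume ∧ IsL2Lipschitz (12 * B) u ∧
      IsRieszSum (reData χ x y t ω) (imData χ x y t ω) u := by
  -- Convergence of the principal value needs pointwise Hölder bounds, hence the continuous
  -- representative.
  obtain ⟨W, hWc, hW⟩ := exists_continuous_ae_eq_of_isL2Lipschitz hω (by positivity) hL
  have hWL : MemLp W 2 volume := hω.ae_eq hW
  have hWLip := hL.congr_ae hW
  have hfL : MemLp (imData χ x y t W) 2 volume := memLp_imData hs hWL.aestronglyMeasurable
  have hpv : ∀ l, HasPVIntegral (imData χ x y t W) l (∫ ζ, pvIntegrand (imData χ x y t W) l ζ) := by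
    intro l
    refine hasPVIntegral_of_holder (K := 1 / 4 * (5 * (12 * B)) + c) hfL fun ζ hζ => ?_
    have h1 := abs_im_sub_le hs (psi x y t W ζ) (x - ζ * y - ζ ^ 2 * t + W l) ζ
    have h2 := Convex.norm_image_sub_le_of_norm_hasDerivWithin_le (s := Set.univ) (C := c)
      (x := l) (y := ζ) (fun μ _ => (hasDerivAt_curve hs hj x y t (W l) μ).hasDerivWithinAt)
      (fun μ _ => (hb _ μ).trans (hbb μ)) convex_univ (Set.mem_univ _) (Set.mem_univ _)
    have h3 := (Complex.abs_im_le_norm _).trans h2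
    have h4 := hWLip.holder hWL hWc (by positivity) l ζ
    have h5 : |ζ - l| ≤ √|ζ - l| := by
      have hq := Real.sqrt_nonneg |ζ - l|
      have hq1 : √|ζ - l| ≤ 1 := Real.sqrt_le_one.2 hζ
      nlinarith [Real.mul_self_sqrt (abs_nonneg (ζ - l))]
    have hc : 0 ≤ c := (norm_nonneg _).trans ((hb 0 0).trans (hbb 0))
    rw [psi_add, add_sub_add_left_eq_sub] at h1
    simp only [Complex.sub_im, Real.norm_eq_abs] at h3
    have h6 : |imData χ x y t W ζ - imData χ x y t W l| ≤ 1 / 4 * |W ζ - W l| + c * |ζ - l| := by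
      refine le_trans ?_ (add_le_add h1 h3)
      refine le_trans (le_of_eq ?_) (abs_add_le _ _)
      simp only [imData, psi_add]
      congr 1; ring
    nlinarith [mul_le_mul_of_nonneg_left h5 hc]
  set u : ℝ → ℝ := fun l => -reData χ x y t W l
    - 1 / Real.pi * ∫ ζ, pvIntegrand (imData χ x y t W) l ζ with hu
  have hsum : IsRieszSum (reData χ x y t W) (imData χ x y t W) u :=
    ae_of_all _ fun l => ⟨_, hpv l, rfl⟩
  refine ⟨u, hsum.memLp (memLp_reData hs hWL.aestronglyMeasurable) hfL, fun h => ?_, ?_⟩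
  · have h1 := eLpNorm_translate_sub_le hs hj hWL.aestronglyMeasurable hsum hbc
      (fun l μ => hb (W l) μ) h
    refine h1.trans ?_
    -- The constant `12B` reproduces itself: `3(12B/4 + B) = 12B`.
    calc 3 * (ENNReal.ofReal (1 / 4) * eLpNorm (fun l => W (l + h) - W l) 2 volume
          + ENNReal.ofReal |h| * eLpNorm b 2 volume)
        ≤ ENNReal.ofReal 3 * (ENNReal.ofReal (1 / 4) * ENNReal.ofReal (12 * B * |h|)
          + ENNReal.ofReal |h| * ENNReal.ofReal B) := by
          rw [show (3 : ENNReal) = ENNReal.ofReal 3 by simp]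
          gcongr
          exact hWLip h
      _ ≤ ENNReal.ofReal (12 * B * |h|) := by
          rw [← ENNReal.ofReal_mul (by norm_num), ← ENNReal.ofReal_mul (abs_nonneg h),
            ← ENNReal.ofReal_add (by positivity) (by positivity),
            ← ENNReal.ofReal_mul (by norm_num)]
          apply ENNReal.ofReal_le_ofReal
          nlinarith [mul_nonneg hB0 (abs_nonneg h)]
  · refine hsum.congr_ae ?_ ?_ (ae_eq_refl u) <;>
    · filter_upwards [hW] with l hl
      simp [reData, imData, psi_add, hl]

end

/-! ### Existence by the contraction principle. -/

/-- Each translation is an isometry of L², so every single `h` imposes a closed condition.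
Closedness supplies the completeness needed for the fixed point. -/
theorem isClosed_setOf_isL2Lipschitz {M : ℝ} (hM : 0 ≤ M) :
    IsClosed {f : Lp ℝ 2 (volume : Measure ℝ) | IsL2Lipschitz M f} := by
  have e : {f : Lp ℝ 2 (volume : Measure ℝ) | IsL2Lipschitz M f}
      = ⋂ h : ℝ, {f : Lp ℝ 2 (volume : Measure ℝ) |
        ‖Lp.compMeasurePreserving (· + h) (measurePreserving_add_right volume h) f - f‖
          ≤ M * |h|} := by
    ext f
    simp only [Set.mem_iInter, Set.mem_ofPred_eq, IsL2Lipschitz]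
    refine forall_congr' fun h => ?_
    rw [Lp.norm_def, ← ENNReal.le_ofReal_iff_toReal_le (Lp.eLpNorm_ne_top _) (by positivity)]
    refine iff_of_eq (congrArg (· ≤ _) (eLpNorm_congr_ae ?_))
    filter_upwards [Lp.coeFn_sub (Lp.compMeasurePreserving (· + h)
      (measurePreserving_add_right volume h) f) f, Lp.coeFn_compMeasurePreserving f
      (measurePreserving_add_right volume h)] with x h1 h2
    rw [h1, Pi.sub_apply, h2, Function.comp]
  rw [e]
  refine isClosed_iInter fun h => isClosed_le ?_ continuous_const
  exact ((Lp.isometry_compMeasurePreserving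
    (measurePreserving_add_right volume h)).continuous.sub continuous_id).norm

theorem exists_isInverseSolution_of_bound {χ : ℝ → ℝ → ℂ} {x y t B c : ℝ} {b : ℝ → ℝ}
    (hs : SolvabilityConditions χ) (hj : JostConditions χ) (hB0 : 0 ≤ B) (hbc : Continuous b)
    (hb : ∀ a μ, ‖curveDeriv χ x y t a μ‖ ≤ b μ) (hbb : ∀ μ, b μ ≤ c)
    (hB : eLpNorm b 2 volume ≤ ENNReal.ofReal B) :
    ∃ ω, IsInverseSolution χ x y t ω ∧ Continuous ω := by
  set S : Set (Lp ℝ 2 (volume : Measure ℝ)) := {f | IsL2Lipschitz (12 * B) f} with hS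
  have hSc : IsClosed S := isClosed_setOf_isL2Lipschitz (by positivity)
  have hstep : ∀ f : S, ∃ g : S, IsRieszSum (reData χ x y t f) (imData χ x y t f) g := by
    intro f
    obtain ⟨u, hu, huL, hsum⟩ := exists_isRieszSum_isL2Lipschitz hs hj (Lp.memLp f.1) hB0 f.2 hbc
      hb hbb hB
    exact ⟨⟨hu.toLp u, huL.congr_ae hu.coeFn_toLp.symm⟩,
      hsum.congr_ae (ae_eq_refl _) (ae_eq_refl _) hu.coeFn_toLp.symm⟩
  choose T hT using hstep
  have hcontr : ContractingWith (3 / 4) T := by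
    refine ⟨by rw [← NNReal.coe_lt_coe]; norm_num, fun f g => ?_⟩
    have h := eLpNorm_sub_le_of_isRieszSum hs (Lp.aestronglyMeasurable f.1)
      (Lp.aestronglyMeasurable g.1) (hT f) (hT g)
    rw [Subtype.edist_eq, Subtype.edist_eq, Lp.edist_def, Lp.edist_def]
    refine h.trans_eq ?_
    rw [← mul_assoc]
    congr 1
    rw [show (3 : ENNReal) = ENNReal.ofReal 3 by simp, ← ENNReal.ofReal_mul (by norm_num),
      ENNReal.ofReal, ENNReal.coe_inj]
    ext
    norm_num
  have : CompleteSpace S := hSc.completeSpace_coe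
  have : Nonempty S := by
    refine ⟨⟨0, ?_⟩⟩
    have h0 : IsL2Lipschitz (12 * B) fun _ => 0 := fun h => by simp
    exact h0.congr_ae (Lp.coeFn_zero ℝ 2 volume).symm
  obtain ⟨f, hf⟩ : ∃ f : S, T f = f := ⟨_, hcontr.fixedPoint_isFixedPt⟩
  have hfs := hT f
  rw [hf] at hfs
  obtain ⟨W, hWc, hW⟩ := exists_continuous_ae_eq_of_isL2Lipschitz (Lp.memLp f.1)
    (by positivity) f.2
  refine ⟨W, isInverseSolution_iff.2 ⟨(Lp.memLp f.1).ae_eq hW, hfs.congr_ae ?_ ?_ hW⟩, hWc⟩ <;>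
  · filter_upwards [hW] with l hl
    simp [reData, imData, psi_add, hl]

theorem one_add_abs_div_one_add_abs_cube_le (μ : ℝ) :
    (1 + |μ|) / (1 + |μ| ^ 3) ≤ 4 / (1 + |μ|) := by
  have hm := abs_nonneg μ
  rw [div_le_div_iff₀ (by positivity) (by positivity)]
  nlinarith [mul_nonneg hm (sq_nonneg (|μ| - 1)), sq_nonneg (|μ| - 1), pow_nonneg hm 3]

/-- The phase derivative grows linearly in `μ`, and the cubic decay of `∂_ξ χ` in the spectral
variable absorbs it, leaving a square-integrable bound independent of `a`. -/
theorem exists_norm_curveDeriv_le {χ : ℝ → ℝ → ℂ} (hj : JostConditions χ) (x y t : ℝ) :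
    ∃ c, 0 ≤ c ∧ ∀ a μ, ‖curveDeriv χ x y t a μ‖ ≤ c / (1 + |μ|) := by
  obtain ⟨C, hC, hbd⟩ := hj.global_bounds
  refine ⟨C * (4 * (|y| + 2 * |t|) + 1), by positivity, fun a μ => ?_⟩
  obtain ⟨-, -, h3, -, -, h6⟩ := hbd (x - μ * y - μ ^ 2 * t + a) μ
  have hm := abs_nonneg μ
  have e1 : |-y - 2 * μ * t| ≤ (|y| + 2 * |t|) * (1 + |μ|) := by
    have := abs_sub (-y) (2 * μ * t)
    rw [abs_neg, abs_mul, abs_mul, abs_two] at this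
    nlinarith [abs_nonneg y, abs_nonneg t, mul_nonneg (abs_nonneg y) hm]
  refine (norm_add_le _ _).trans ?_
  rw [norm_smul, Real.norm_eq_abs]
  calc |-y - 2 * μ * t| * ‖dXi χ (x - μ * y - μ ^ 2 * t + a) μ‖
        + ‖dLam χ (x - μ * y - μ ^ 2 * t + a) μ‖
      ≤ (|y| + 2 * |t|) * (1 + |μ|) * (C / (1 + |μ| ^ 3)) + C / (1 + |μ|) := by gcongr
    _ = C * (|y| + 2 * |t|) * ((1 + |μ|) / (1 + |μ| ^ 3)) + C / (1 + |μ|) := by ring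
    _ ≤ C * (|y| + 2 * |t|) * (4 / (1 + |μ|)) + C / (1 + |μ|) := by
      exact add_le_add (mul_le_mul_of_nonneg_left (one_add_abs_div_one_add_abs_cube_le μ)
        (by positivity)) le_rfl
    _ = C * (4 * (|y| + 2 * |t|) + 1) / (1 + |μ|) := by ring

theorem exists_isInverseSolution {χ : ℝ → ℝ → ℂ} (hs : SolvabilityConditions χ)
    (hj : JostConditions χ) (x y t : ℝ) : ∃ ω, IsInverseSolution χ x y t ω ∧ Continuous ω := by
  obtain ⟨c, hc, hb⟩ := exists_norm_curveDeriv_le hj x y t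
  exact exists_isInverseSolution_of_bound hs hj ENNReal.toReal_nonneg
    (continuous_const.div (by fun_prop) fun μ => by positivity) hb
    (fun μ => div_le_self hc (by linarith [abs_nonneg μ]))
    (ENNReal.ofReal_toReal (memLp_one_div_one_add_abs c).2.ne).ge

/-! ### Cauchy's theorem and the Plemelj relation. -/

theorem IsLowerHalfPlaneBoundaryValue.comp_affine {f : ℝ → ℂ}
    (hf : IsLowerHalfPlaneBoundaryValue f) (a : ℝ) {Y : ℝ} (hY : 0 < Y) :
    IsLowerHalfPlaneBoundaryValue fun s => f (a + Y * s) := by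
  obtain ⟨F, hc, hd, ht, hb⟩ := hf
  have him : ∀ z : ℂ, ((a : ℂ) + Y * z).im = Y * z.im := fun z => by simp
  have haff : Tendsto (fun z : ℂ => (a : ℂ) + Y * z) (cocompact ℂ) (cocompact ℂ) :=
    ((Homeomorph.mulLeft₀ (Y : ℂ) (by exact_mod_cast hY.ne')).trans
      (Homeomorph.addLeft (a : ℂ))).isClosedEmbedding.tendsto_cocompact
  refine ⟨fun z => F (a + Y * z), ?_, ?_, ?_, fun ξ => ?_⟩
  · refine hc.comp (by fun_prop) fun z hz => ?_
    rw [Set.mem_ofPred_eq] at hz ⊢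
    rw [him]
    exact mul_nonpos_of_nonneg_of_nonpos hY.le hz
  · refine hd.comp (by fun_prop) fun z hz => ?_
    rw [Set.mem_ofPred_eq] at hz ⊢
    rw [him]
    exact mul_neg_of_pos_of_neg hY hz
  · refine ht.comp (haff.inf (tendsto_principal_principal.2 fun z hz => ?_))
    rw [Set.mem_ofPred_eq] at hz ⊢
    rw [him]
    exact mul_nonpos_of_nonneg_of_nonpos hY.le hz
  · simp only [← hb]; push_cast; rfl

/-- Cauchy's theorem in the lower half-plane, with a simple pole in the upper half-plane. -/
theorem tendsto_intervalIntegral_div_sub {F : ℂ → ℂ} (hc : ContinuousOn F {z : ℂ | z.im ≤ 0})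
    (hd : DifferentiableOn ℂ F {z : ℂ | z.im < 0})
    (ht : Tendsto F (cocompact ℂ ⊓ 𝓟 {z : ℂ | z.im ≤ 0}) (𝓝 0)) {w : ℂ} (hw : 0 < w.im) :
    Tendsto (fun R : ℝ => ∫ s in (-R)..R, F s / (s - w)) atTop (𝓝 0) := by
  rw [Metric.tendsto_nhds]
  intro e he
  have h1 : ∀ᶠ z : ℂ in cocompact ℂ, z.im ≤ 0 → ‖F z‖ ≤ e / 16 := by
    have := (Metric.tendsto_nhds.1 ht) (e / 16) (by positivity)
    rw [eventually_inf_principal] at this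
    filter_upwards [this] with z hz hz'
    have := hz hz'
    rw [dist_zero_right] at this
    exact this.le
  rw [← Metric.cobounded_eq_cocompact, hasBasis_cobounded_norm.eventually_iff] at h1
  obtain ⟨R₀, -, hR₀⟩ := h1
  filter_upwards [eventually_ge_atTop R₀, eventually_ge_atTop (2 * ‖w‖), eventually_gt_atTop 0]
    with R hR1 hR2 hR
  set g : ℂ → ℂ := fun z => F z / (z - w) with hg
  have hne : ∀ z : ℂ, z.im ≤ 0 → z - w ≠ 0 := fun z hz h => by
    have := congrArg Complex.im (sub_eq_zero.1 h)
    linarith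
  have hgc : ContinuousOn g {z : ℂ | z.im ≤ 0} :=
    hc.div (by fun_prop) fun z hz => hne z hz
  have hgd : DifferentiableOn ℂ g {z : ℂ | z.im < 0} :=
    hd.div (by fun_prop) fun z hz => hne z (le_of_lt hz)
  -- On the three lower sides of `[-R, R] × [-R, 0]`, of total length `4R`, this bound contributes
  -- at most `e/2`.
  have hbd : ∀ z : ℂ, z.im ≤ 0 → R ≤ ‖z‖ → ‖g z‖ ≤ e / (8 * R) := fun z hz hzR => by
    have h2 : ‖F z‖ ≤ e / 16 := hR₀ (show R₀ ≤ ‖z‖ from hR1.trans hzR) hz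
    have h3 : R / 2 ≤ ‖z - w‖ := by
      have := norm_sub_norm_le z w
      linarith
    rw [hg, norm_div]
    calc ‖F z‖ / ‖z - w‖ ≤ (e / 16) / (R / 2) := by gcongr
      _ = e / (8 * R) := by field_simp; ring
  have hrect := Complex.integral_boundary_rect_eq_zero_of_continuousOn_of_differentiableOn g
    (⟨-R, -R⟩ : ℂ) (⟨R, 0⟩ : ℂ)
    (hgc.mono fun z hz => by
      rw [Complex.mem_reProdIm] at hz
      have := hz.2
      rw [Set.uIcc_of_le (by simp only; linarith)] at this
      exact this.2)
    (hgd.mono fun z hz => by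
      rw [Complex.mem_reProdIm] at hz
      have := hz.2.2
      rw [max_eq_right (by simp only; linarith)] at this
      exact this)
  simp only at hrect
  have i1 : ‖∫ s in (-R)..R, g (s + ((-R : ℝ) : ℂ) * Complex.I)‖ ≤ e / (8 * R) * |R - -R| := by
    refine intervalIntegral.norm_integral_le_of_norm_le_const fun s _ => hbd _ (by simp [hR.le]) ?_
    refine le_trans ?_ (Complex.abs_im_le_norm _)
    simp [abs_of_pos hR]
  have i2 : ‖∫ s in (-R)..0, g ((R : ℂ) + s * Complex.I)‖ ≤ e / (8 * R) * |0 - -R| := by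
    refine intervalIntegral.norm_integral_le_of_norm_le_const fun s hs => hbd _ ?_ ?_
    · rw [Set.uIoc_of_le (by linarith)] at hs
      simpa using hs.2
    · refine le_trans ?_ (Complex.abs_re_le_norm _)
      simp [abs_of_pos hR]
  have i3 : ‖∫ s in (-R)..0, g (((-R : ℝ) : ℂ) + s * Complex.I)‖ ≤ e / (8 * R) * |0 - -R| := by
    refine intervalIntegral.norm_integral_le_of_norm_le_const fun s hs => hbd _ ?_ ?_
    · rw [Set.uIoc_of_le (by linarith)] at hs
      simpa using hs.2
    · refine le_trans ?_ (Complex.abs_re_le_norm _)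
      simp [abs_of_pos hR]
  have e0 : ∫ s in (-R)..R, g ((s : ℂ) + ((0 : ℝ) : ℂ) * Complex.I)
      = ∫ s in (-R)..R, F s / (s - w) := by simp [hg]
  rw [e0] at hrect
  have hsol : ∫ s in (-R)..R, F s / (s - w)
      = (∫ s in (-R)..R, g (s + ((-R : ℝ) : ℂ) * Complex.I))
        + Complex.I • (∫ s in (-R)..0, g ((R : ℂ) + s * Complex.I))
        - Complex.I • ∫ s in (-R)..0, g (((-R : ℝ) : ℂ) + s * Complex.I) := by
    linear_combination -hrect
  rw [dist_zero_right, hsol]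
  have a1 : |R - -R| = 2 * R := by rw [abs_of_pos (by linarith)]; ring
  have a2 : |0 - -R| = R := by rw [abs_of_pos (by linarith)]; ring
  rw [a1] at i1
  rw [a2] at i2 i3
  have t1 : e / (8 * R) * (2 * R) = e / 4 := by field_simp; ring
  have t2 : e / (8 * R) * R = e / 8 := by field_simp
  rw [t1] at i1
  rw [t2] at i2 i3
  refine (norm_sub_le _ _).trans_lt ?_
  rw [norm_smul, Complex.norm_I, one_mul]
  have := norm_add_le (∫ s in (-R)..R, g (s + ((-R : ℝ) : ℂ) * Complex.I))
    (Complex.I • ∫ s in (-R)..0, g ((R : ℂ) + s * Complex.I))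
  rw [norm_smul, Complex.norm_I, one_mul] at this
  linarith

theorem memLp_poissonKernel {ε : ℝ} (hε : 0 < ε) : MemLp (poissonKernel ε) 2 volume := by
  have hc := continuous_poissonKernel hε
  rw [memLp_two_iff_integrable_sq hc.aestronglyMeasurable]
  refine ((integrable_poissonKernel hε).const_mul ε⁻¹).mono' (hc.pow 2).aestronglyMeasurable
    (ae_of_all _ fun u => ?_)
  rw [Real.norm_of_nonneg (sq_nonneg _), sq]
  refine mul_le_mul_of_nonneg_right ?_ (poissonKernel_nonneg hε u)
  rw [poissonKernel, div_le_iff₀ (by positivity), inv_mul_eq_div, le_div_iff₀ hε]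
  nlinarith [sq_nonneg u]

theorem tendsto_integral_poissonKernel {f : ℝ → ℝ} {c : ℝ} (hf : Continuous f)
    (hc : ∀ ξ, |f ξ| ≤ c) (x : ℝ) :
    Tendsto (fun ε => ∫ ζ, f ζ * poissonKernel ε (ζ - x)) (𝓝[>] 0) (𝓝 (Real.pi * f x)) := by
  have key : ∀ ε : ℝ, 0 < ε → ∫ s, f (x + ε * s) * (1 + s ^ 2)⁻¹
      = ∫ ζ, f ζ * poissonKernel ε (ζ - x) := fun ε hε => by
    have h1 := integral_sub_right_eq_self (fun u => f (x + u) * poissonKernel ε u) (μ := volume) x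
    simp only [add_sub_cancel] at h1
    have h2 := Measure.integral_comp_mul_left (fun u => f (x + u) * poissonKernel ε u) ε
    rw [← h1, smul_eq_mul, abs_of_pos (inv_pos.2 hε)] at h2
    have e : ∀ s, f (x + ε * s) * poissonKernel ε (ε * s)
        = ε⁻¹ * (f (x + ε * s) * (1 + s ^ 2)⁻¹) := fun s => by
      simp only [poissonKernel]; field_simp; ring
    simp_rw [e] at h2
    rw [integral_const_mul] at h2
    exact mul_left_cancel₀ (inv_pos.2 hε).ne' h2
  have hlim : Tendsto (fun ε => ∫ s, f (x + ε * s) * (1 + s ^ 2)⁻¹) (𝓝[>] 0)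
      (𝓝 (∫ s : ℝ, f x * (1 + s ^ 2)⁻¹)) := by
    refine tendsto_integral_filter_of_dominated_convergence (fun s => c * (1 + s ^ 2)⁻¹) ?_ ?_
      (integrable_inv_one_add_sq.const_mul c) (ae_of_all _ fun s => ?_)
    · exact Eventually.of_forall fun ε => ((hf.comp (by fun_prop)).aestronglyMeasurable.mul
        integrable_inv_one_add_sq.aestronglyMeasurable)
    · refine Eventually.of_forall fun ε => ae_of_all _ fun s => ?_
      rw [norm_mul, Real.norm_of_nonneg (by positivity : (0 : ℝ) ≤ (1 + s ^ 2)⁻¹)]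
      exact mul_le_mul_of_nonneg_right (hc _) (by positivity)
    · have h : Continuous fun ε : ℝ => f (x + ε * s) * (1 + s ^ 2)⁻¹ := by fun_prop
      have := (h.tendsto 0).mono_left (nhdsWithin_le_nhds (s := Set.Ioi 0))
      simpa using this
  rw [integral_const_mul, integral_univ_inv_one_add_sq, mul_comm] at hlim
  refine hlim.congr' ?_
  filter_upwards [self_mem_nhdsWithin] with ε hε using key ε hε

theorem inv_sub_add_mul_I {ε : ℝ} (hε : 0 < ε) (x ζ : ℝ) :
    ((ζ : ℂ) - (x + ε * Complex.I))⁻¹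
      = (conjKernel ε (ζ - x) : ℂ) + (poissonKernel ε (ζ - x) : ℂ) * Complex.I := by
  have h1 : (ζ - x) ^ 2 + ε ^ 2 ≠ 0 := by positivity
  have h2 : ((ζ : ℂ) - (x + ε * Complex.I)) ≠ 0 := fun h => by
    have := congrArg Complex.im h
    simp at this
    exact hε.ne' this
  have h3 : ((ζ : ℂ) - x) ^ 2 + (ε : ℂ) ^ 2 ≠ 0 := by exact_mod_cast h1
  simp only [conjKernel, poissonKernel]
  push_cast
  rw [inv_eq_of_mul_eq_one_right]
  field_simp
  linear_combination (-(ε : ℂ) ^ 2) * Complex.I_sq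

/-- The Plemelj relation for boundary values of functions holomorphic in the lower half-plane. -/
theorem hasPVIntegral_im_of_boundaryValue {f : ℝ → ℂ} {c K x : ℝ}
    (hf : IsLowerHalfPlaneBoundaryValue f) (hfc : Continuous f)
    (hdec : ∀ ξ, ‖f ξ‖ ≤ c / (1 + |ξ|))
    (hK : ∀ ζ, |ζ - x| ≤ 1 → ‖f ζ - f x‖ ≤ K * √|ζ - x|) :
    HasPVIntegral (fun ζ => (f ζ).im) x (-(Real.pi * (f x).re)) := by
  have hfL : MemLp f 2 volume := memLp_two_of_le hfc.aestronglyMeasurable hdec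
  have hc : ∀ ξ, ‖f ξ‖ ≤ c := fun ξ => by
    refine (hdec ξ).trans (div_le_self ?_ (by linarith [abs_nonneg ξ]))
    by_contra h
    have := (norm_nonneg _).trans (hdec 0)
    simp at this
    exact h this
  have hKi : ∀ ζ, |ζ - x| ≤ 1 → |(f ζ).im - (f x).im| ≤ K * √|ζ - x| := fun ζ hζ => by
    rw [← Complex.sub_im]
    exact (Complex.abs_im_le_norm _).trans (hK ζ hζ)
  -- With the pole at `x + iε`, the Cauchy kernel is `Q_ε + iP_ε` and the integral of `f` against it
  -- vanishes; this is the imaginary part. As `ε → 0` the left side tends to the principal value and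
  -- the right side to `-π Re f(x)`.
  have hzero : ∀ ε : ℝ, 0 < ε → ∫ ζ, (f ζ).im * conjKernel ε (ζ - x)
      = -∫ ζ, (f ζ).re * poissonKernel ε (ζ - x) := by
    intro ε hε
    obtain ⟨F, hFc, hFd, hFt, hFb⟩ := hf
    have h0 := tendsto_intervalIntegral_div_sub hFc hFd hFt (w := x + ε * Complex.I)
      (by simpa using hε)
    have ia := integrable_mul_translate hfL.re (memLp_conjKernel hε) x
    have ib := integrable_mul_translate hfL.im (memLp_poissonKernel hε) x
    have ic := integrable_mul_translate hfL.im (memLp_conjKernel hε) x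
    have id := integrable_mul_translate hfL.re (memLp_poissonKernel hε) x
    have e : ∀ s : ℝ, F s / (s - (x + ε * Complex.I))
        = (((f s).re * conjKernel ε (s - x) - (f s).im * poissonKernel ε (s - x) : ℝ) : ℂ)
          + (((f s).im * conjKernel ε (s - x) + (f s).re * poissonKernel ε (s - x) : ℝ) : ℂ)
            * Complex.I := fun s => by
      rw [hFb, div_eq_mul_inv, inv_sub_add_mul_I hε]
      apply Complex.ext
      · simp
      · simp; ring
    simp_rw [e] at h0
    have i1 : Integrable fun s : ℝ =>
        (f s).re * conjKernel ε (s - x) - (f s).im * poissonKernel ε (s - x) := ia.sub ib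
    have i2 : Integrable fun s : ℝ =>
        (f s).im * conjKernel ε (s - x) + (f s).re * poissonKernel ε (s - x) := ic.add id
    have hint := i1.ofReal (𝕜 := ℂ).add (i2.ofReal (𝕜 := ℂ).mul_const Complex.I)
    have h1 := tendsto_nhds_unique
      (intervalIntegral_tendsto_integral hint tendsto_neg_atTop_atBot tendsto_id) h0
    have h2 : (∫ s, (((f s).re * conjKernel ε (s - x)
        - (f s).im * poissonKernel ε (s - x) : ℝ) : ℂ))
        + ∫ s, (((f s).im * conjKernel ε (s - x) + (f s).re * poissonKernel ε (s - x) : ℝ) : ℂ)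
            * Complex.I = 0 := by
      rw [← h1]
      exact (integral_add i1.ofReal (i2.ofReal.mul_const Complex.I)).symm
    rw [integral_mul_const, integral_complex_ofReal, integral_complex_ofReal] at h2
    have h3 := congrArg Complex.im h2
    simp only [Complex.add_im, Complex.ofReal_im, Complex.mul_im, Complex.I_im, Complex.I_re,
      Complex.ofReal_re, mul_one, mul_zero, add_zero, zero_add, Complex.zero_im] at h3
    have h4 : ∫ s, ((f s).im * conjKernel ε (s - x) + (f s).re * poissonKernel ε (s - x))
        = (∫ s, (f s).im * conjKernel ε (s - x)) + ∫ s, (f s).re * poissonKernel ε (s - x) :=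
      integral_add ic id
    linarith
  have hl1 := tendsto_integral_conjKernel_of_holder hfL.im hKi
  have hl2 := (tendsto_integral_poissonKernel (f := fun ζ => (f ζ).re) (c := c)
    (Complex.continuous_re.comp hfc) (fun ξ => (Complex.abs_re_le_norm _).trans (hc ξ)) x).neg
  have hv := tendsto_nhds_unique (hl1.congr' (by
    filter_upwards [self_mem_nhdsWithin] with ε hε using hzero ε hε)) hl2
  rw [← hv]
  exact hasPVIntegral_of_holder hfL.im hKi

/-- This is where analyticity enters: along a line in `ξ` with `λ` frozen, `R` and the Hilbert
transform of `I` cancel, so the rescaled profile forces no response at all. -/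
theorem isRieszSum_zero_of_boundaryValue {χ : ℝ → ℝ → ℂ} (hs : SolvabilityConditions χ)
    (hj : JostConditions χ) (lam a : ℝ) {Y : ℝ} (hY : 0 < Y) :
    MemLp (fun l => χ (a + Y * l) lam) 2 volume ∧
    IsRieszSum (fun l => (χ (a + Y * l) lam).re) (fun l => (χ (a + Y * l) lam).im)
      (fun _ => 0) := by
  obtain ⟨C, hC, hbd⟩ := hj.global_bounds
  have hcont : Continuous fun l => χ (a + Y * l) lam :=
    hs.continuous.comp (f := fun l => (a + Y * l, lam)) (by fun_prop)
  have hdec : ∀ l, ‖χ (a + Y * l) lam‖ ≤ C * (1 + (|a| + 1) / Y) / (1 + |l|) := fun l => by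
    refine (hbd (a + Y * l) lam).2.1.trans ?_
    rw [div_le_div_iff₀ (by positivity) (by positivity), mul_assoc]
    refine mul_le_mul_of_nonneg_left ?_ hC.le
    have h1 : Y * |l| ≤ |a + Y * l| + |a| := by
      have := abs_sub (a + Y * l) a
      rwa [add_sub_cancel_left, abs_mul, abs_of_pos hY] at this
    have h2 : |l| ≤ (|a + Y * l| + |a|) / Y := by rw [le_div_iff₀ hY]; linarith
    have h3 : (1 + (|a| + 1) / Y) * (1 + |a + Y * l|) = 1 + |a + Y * l|
      + ((|a + Y * l| + |a|) / Y + (1 + |a| * |a + Y * l|) / Y) := by field_simp; ring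
    rw [h3]
    have h4 : 0 ≤ (1 + |a| * |a + Y * l|) / Y := by positivity
    linarith [abs_nonneg (a + Y * l)]
  refine ⟨memLp_two_of_le hcont.aestronglyMeasurable hdec, ae_of_all _ fun x => ?_⟩
  refine ⟨_, hasPVIntegral_im_of_boundaryValue (K := C * Y) ((hj.holomorphic lam).comp_affine a hY)
    hcont hdec fun ζ hζ => ?_, ?_⟩
  · have h := Convex.norm_image_sub_le_of_norm_hasDerivWithin_le (s := Set.univ) (C := C)
      (f := fun s => χ s lam) (x := a + Y * x) (y := a + Y * ζ)
      (fun s _ => (hasDerivAt_dXi hs s lam).hasDerivWithinAt)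
      (fun s _ => (hbd s lam).2.2.2.1.trans (div_le_self hC.le (by simp [sq_nonneg])))
      convex_univ (Set.mem_univ _) (Set.mem_univ _)
    rw [add_sub_add_left_eq_sub, ← mul_sub, norm_mul, Real.norm_of_nonneg hY.le, ← mul_assoc] at h
    refine h.trans (mul_le_mul_of_nonneg_left ?_ (by positivity))
    rw [Real.norm_eq_abs]
    have hq := Real.sqrt_nonneg |ζ - x|
    have hq1 : √|ζ - x| ≤ 1 := Real.sqrt_le_one.2 hζ
    nlinarith [Real.mul_self_sqrt (abs_nonneg (ζ - x))]
  · field_simp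
    ring

/-! ### Asymptotics as `y → -∞`, with `Y = -y`. -/

/-- The kernel is at most `1/ε` and has mass π. With `ε = 1/Y` this is the source of the growth
`√Y`. -/
theorem eLpNorm_poissonKernel_le {ε : ℝ} (hε : 0 < ε) :
    eLpNorm (poissonKernel ε) 2 volume ≤ ENNReal.ofReal (√(Real.pi / ε)) := by
  rw [eLpNorm_two_eq_sqrt (memLp_poissonKernel hε)]
  refine ENNReal.ofReal_le_ofReal (Real.sqrt_le_sqrt ?_)
  rw [div_eq_inv_mul, ← integral_poissonKernel hε, ← integral_const_mul]
  refine integral_mono (memLp_poissonKernel hε).integrable_sq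
    ((integrable_poissonKernel hε).const_mul _) fun u => ?_
  simp only [sq]
  refine mul_le_mul_of_nonneg_right ?_ (poissonKernel_nonneg hε u)
  rw [poissonKernel, div_le_iff₀ (by positivity), inv_mul_eq_div, le_div_iff₀ hε]
  nlinarith [sq_nonneg u]

section

variable {χ : ℝ → ℝ → ℂ}

/-- The factorization isolates the fixed zero `μ = λ₀`; for `t ≠ 0` the other one, `Y/t - λ₀`,
escapes to infinity with `Y`. -/
theorem phase_eq (τ lam₀ t Y μ : ℝ) :
    (τ + lam₀ * -Y) - μ * -Y - μ ^ 2 * t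
      = (τ - lam₀ ^ 2 * t) + (μ - lam₀) * (Y - t * (μ + lam₀)) := by ring

/-- Away from the second zero of the phase, the phase is comparable to `Y (μ - λ₀)`. -/
theorem abs_mul_sub_le_of_abs_le {t Y lam₀ μ : ℝ} (hY : 0 < Y) (h : |t * (μ + lam₀)| ≤ Y / 2) :
    |Y * (μ - lam₀)| ≤ 2 * |(μ - lam₀) * (Y - t * (μ + lam₀))| := by
  have h1 : Y / 2 ≤ |Y - t * (μ + lam₀)| := by
    refine le_trans ?_ (le_abs_self _)
    linarith [le_abs_self (t * (μ + lam₀))]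
  rw [abs_mul, abs_mul, abs_of_pos hY]
  nlinarith [mul_le_mul_of_nonneg_left h1 (abs_nonneg (μ - lam₀))]

theorem one_add_sq_le_mul {s q W T : ℝ} (h : |s| ≤ 2 * (|q| + W + |T|)) :
    1 + s ^ 2 ≤ 12 * (1 + T ^ 2) * (1 + W ^ 2) * (1 + |q| ^ 2) := by
  have h1 : |s| ^ 2 ≤ (2 * (|q| + W + |T|)) ^ 2 := by gcongr
  have h2 : (2 * (|q| + W + |T|)) ^ 2 ≤ 12 * (|q| ^ 2 + W ^ 2 + |T| ^ 2) := by
    nlinarith [sq_nonneg (|q| - W), sq_nonneg (|q| - |T|), sq_nonneg (W - |T|)]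
  have h3 : 0 ≤ T ^ 2 * W ^ 2 + T ^ 2 * |q| ^ 2 + W ^ 2 * |q| ^ 2 + T ^ 2 * W ^ 2 * |q| ^ 2 := by
    positivity
  have h4 : 12 * (1 + T ^ 2) * (1 + W ^ 2) * (1 + |q| ^ 2) = 12 * (1 + (|q| ^ 2 + W ^ 2 + T ^ 2)
      + (T ^ 2 * W ^ 2 + T ^ 2 * |q| ^ 2 + W ^ 2 * |q| ^ 2 + T ^ 2 * W ^ 2 * |q| ^ 2)) := by ring
  rw [sq_abs] at h1
  rw [sq_abs T] at h2
  linarith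

/-- Near `λ₀` the phase derivative has size `Y`, and the decay of `∂_ξ χ` in `ξ` confines it to a
window of width `1/Y`: this is a Poisson kernel. The factor `1 + W²` pays for shifting the phase by
`a`. -/
theorem exists_norm_curveDeriv_le_poissonKernel (hj : JostConditions χ) (τ lam₀ t : ℝ) :
    ∃ c, 0 ≤ c ∧ ∀ Y W a μ : ℝ, 1 ≤ Y → |a| ≤ W →
      ‖curveDeriv χ (τ + lam₀ * -Y) (-Y) t a μ‖
        ≤ c * (1 + W ^ 2) * (poissonKernel (1 / Y) (μ - lam₀) + 1 / (1 + |μ|)) := by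
  obtain ⟨C, hC, hbd⟩ := hj.global_bounds
  set τ' := τ - lam₀ ^ 2 * t with hτ'
  set c₁ := (2 + 2 * |t * lam₀|) * C * (12 * (1 + τ' ^ 2)) with hc₁
  set c₂ := 4 * |t| * (1 + |lam₀|) * C * 4 with hc₂
  have hc₁0 : 0 ≤ c₁ := by positivity
  have hc₂0 : 0 ≤ c₂ := by positivity
  refine ⟨c₁ + c₂ + C, by positivity, fun Y W a μ hY ha => ?_⟩
  have hY0 : 0 < Y := by linarith
  set ξ := (τ + lam₀ * -Y) - μ * -Y - μ ^ 2 * t + a with hξ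
  obtain ⟨-, -, h3, h4, -, h6⟩ := hbd ξ μ
  have hP : poissonKernel (1 / Y) (μ - lam₀) = Y / (1 + (Y * (μ - lam₀)) ^ 2) := by
    simp only [poissonKernel]; field_simp; ring
  have hP0 := poissonKernel_nonneg (one_div_pos.2 hY0) (μ - lam₀)
  have hW2 : 1 ≤ 1 + W ^ 2 := by nlinarith [sq_nonneg W]
  have hN0 : 0 ≤ 1 / (1 + |μ|) := by positivity
  have hd : ‖(-(-Y) - 2 * μ * t) • dXi χ ξ μ‖
      ≤ c₁ * (1 + W ^ 2) * poissonKernel (1 / Y) (μ - lam₀)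
        + c₂ * (1 + W ^ 2) * (1 / (1 + |μ|)) := by
    rw [norm_smul, Real.norm_eq_abs, neg_neg]
    -- Either the phase is comparable to `Y(μ - λ₀)` up to bounded shifts, or `Y < 2|t||μ + λ₀|` and
    -- decay in the spectral variable takes over.
    by_cases hA : |t * (μ + lam₀)| ≤ Y / 2
    · refine le_add_of_le_of_nonneg ?_ (by positivity)
      have e1 : |Y - 2 * μ * t| ≤ (2 + 2 * |t * lam₀|) * Y := by
        have : Y - 2 * μ * t = Y - 2 * (t * (μ + lam₀)) + 2 * (t * lam₀) := by ring
        rw [this]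
        have u1 := abs_add_le (Y - 2 * (t * (μ + lam₀))) (2 * (t * lam₀))
        have u2 := abs_sub Y (2 * (t * (μ + lam₀)))
        rw [abs_mul 2, abs_two] at u1 u2
        rw [abs_of_pos hY0] at u2
        nlinarith [mul_le_mul_of_nonneg_left hY (abs_nonneg (t * lam₀))]
      have e2 : 1 + (Y * (μ - lam₀)) ^ 2 ≤ 12 * (1 + τ' ^ 2) * (1 + W ^ 2) * (1 + |ξ| ^ 2) := by
        have u1 := abs_mul_sub_le_of_abs_le hY0 hA
        have u2 : (μ - lam₀) * (Y - t * (μ + lam₀)) = ξ - a - τ' := by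
          rw [hξ, phase_eq]; ring
        rw [u2] at u1
        have u3 : |ξ - a - τ'| ≤ |ξ| + W + |τ'| := by
          have := abs_sub (ξ - a) τ'
          have := abs_sub ξ a
          linarith
        exact one_add_sq_le_mul (by linarith)
      have e3 : C / (1 + |ξ| ^ 2)
          ≤ C * (12 * (1 + τ' ^ 2)) * (1 + W ^ 2) * (1 / (1 + (Y * (μ - lam₀)) ^ 2)) := by
        rw [mul_one_div, div_le_div_iff₀ (by positivity) (by positivity)]
        have := mul_le_mul_of_nonneg_left e2 hC.le
        linarith
      calc |Y - 2 * μ * t| * ‖dXi χ ξ μ‖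
          ≤ ((2 + 2 * |t * lam₀|) * Y) * (C * (12 * (1 + τ' ^ 2)) * (1 + W ^ 2) *
            (1 / (1 + (Y * (μ - lam₀)) ^ 2))) := by
            gcongr; exact h4.trans e3
        _ = c₁ * (1 + W ^ 2) * poissonKernel (1 / Y) (μ - lam₀) := by rw [hP, hc₁]; ring
    · refine le_add_of_nonneg_of_le (by positivity) ?_
      push Not at hA
      rw [abs_mul] at hA
      have v1 := abs_add_le μ lam₀
      have e1 : |Y - 2 * μ * t| ≤ 4 * |t| * (1 + |lam₀|) * (1 + |μ|) := by
        have u2 := abs_sub Y (2 * μ * t)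
        rw [abs_of_pos hY0, abs_mul, abs_mul, abs_two] at u2
        have v2 := mul_le_mul_of_nonneg_left v1 (abs_nonneg t)
        have v3 := mul_nonneg (mul_nonneg (abs_nonneg t) (abs_nonneg lam₀)) (abs_nonneg μ)
        have v4 := mul_nonneg (abs_nonneg t) (abs_nonneg lam₀)
        nlinarith [abs_nonneg t]
      calc |Y - 2 * μ * t| * ‖dXi χ ξ μ‖
          ≤ (4 * |t| * (1 + |lam₀|) * (1 + |μ|)) * (C / (1 + |μ| ^ 3)) := by gcongr
        _ = 4 * |t| * (1 + |lam₀|) * C * ((1 + |μ|) / (1 + |μ| ^ 3)) := by ring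
        _ ≤ 4 * |t| * (1 + |lam₀|) * C * (4 / (1 + |μ|)) := by
          exact mul_le_mul_of_nonneg_left (one_add_abs_div_one_add_abs_cube_le μ) (by positivity)
        _ = c₂ * 1 * (1 / (1 + |μ|)) := by rw [hc₂]; ring
        _ ≤ c₂ * (1 + W ^ 2) * (1 / (1 + |μ|)) := by gcongr
  have hl : ‖dLam χ ξ μ‖ ≤ C * (1 + W ^ 2) * (1 / (1 + |μ|)) := by
    calc ‖dLam χ ξ μ‖ ≤ C * 1 * (1 / (1 + |μ|)) := by
          rw [mul_one, mul_one_div]; exact h6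
      _ ≤ C * (1 + W ^ 2) * (1 / (1 + |μ|)) := by gcongr
  refine (norm_add_le _ _).trans ((add_le_add hd hl).trans ?_)
  have z1 : 0 ≤ (c₂ + C) * (1 + W ^ 2) * poissonKernel (1 / Y) (μ - lam₀) := by positivity
  have z2 : 0 ≤ c₁ * (1 + W ^ 2) * (1 / (1 + |μ|)) := by positivity
  linarith

/-- In the variable `s = Y(μ - λ₀)` this is an L² majorant independent of `Y`, as needed for
dominated convergence. -/
theorem exists_norm_phase_le (hj : JostConditions χ) (τ lam₀ t : ℝ) :
    ∃ c, ∀ Y μ : ℝ, 1 ≤ Y →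
      ‖χ ((τ + lam₀ * -Y) - μ * -Y - μ ^ 2 * t) μ‖ ≤ c / (1 + |Y * (μ - lam₀)|) := by
  obtain ⟨C, hC, hbd⟩ := hj.global_bounds
  set τ' := τ - lam₀ ^ 2 * t with hτ'
  set c₁ := 2 * (1 + |τ'|) with hc₁
  set c₂ := 1 + 4 * |t| * (1 + lam₀ ^ 2) with hc₂
  have hc₁0 : 0 ≤ c₁ := by positivity
  have hc₂0 : 0 ≤ c₂ := by positivity
  refine ⟨C * (c₁ + c₂), fun Y μ hY => ?_⟩
  have hY0 : 0 < Y := by linarith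
  set ξ := (τ + lam₀ * -Y) - μ * -Y - μ ^ 2 * t with hξ
  obtain ⟨h1, h2, -⟩ := hbd ξ μ
  by_cases hA : |t * (μ + lam₀)| ≤ Y / 2
  · refine h2.trans ?_
    rw [div_le_div_iff₀ (by positivity) (by positivity), mul_assoc]
    refine mul_le_mul_of_nonneg_left ?_ hC.le
    have u1 := abs_mul_sub_le_of_abs_le hY0 hA
    have u2 : (μ - lam₀) * (Y - t * (μ + lam₀)) = ξ - τ' := by
      rw [hξ, phase_eq]; ring
    rw [u2] at u1
    have u3 := abs_sub ξ τ'
    have u4 : 1 + |Y * (μ - lam₀)| ≤ c₁ * (1 + |ξ|) := by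
      rw [hc₁]
      nlinarith [abs_nonneg ξ, abs_nonneg τ', mul_nonneg (abs_nonneg ξ) (abs_nonneg τ')]
    have u5 : 0 ≤ c₂ * (1 + |ξ|) := by positivity
    linarith
  -- Here `Y` is controlled by `|μ| + |λ₀|`, so `|Y(μ - λ₀)|` is at most a multiple of `1 + μ²`,
  -- which the quadratic decay of `χ` compensates.
  · refine h1.trans ?_
    rw [div_le_div_iff₀ (by positivity) (by positivity), mul_assoc]
    refine mul_le_mul_of_nonneg_left ?_ hC.le
    push Not at hA
    rw [abs_mul] at hA
    have v1 := abs_add_le μ lam₀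
    have v2 := abs_sub μ lam₀
    have v3 : Y ≤ 2 * |t| * (|μ| + |lam₀|) := by
      have := mul_le_mul_of_nonneg_left v1 (abs_nonneg t)
      linarith
    have v4 : |Y * (μ - lam₀)| ≤ 2 * |t| * (|μ| + |lam₀|) * (|μ| + |lam₀|) := by
      rw [abs_mul, abs_of_pos hY0]; gcongr
    have v5 : (|μ| + |lam₀|) * (|μ| + |lam₀|) ≤ 2 * ((1 + lam₀ ^ 2) * (1 + |μ| ^ 2)) := by
      rw [← sq_abs lam₀]
      nlinarith [sq_nonneg (|μ| - |lam₀|), mul_nonneg (sq_nonneg |μ|) (sq_nonneg |lam₀|)]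
    have v6 : 1 + |Y * (μ - lam₀)| ≤ c₂ * (1 + |μ| ^ 2) := by
      have := mul_le_mul_of_nonneg_left v5 (by positivity : 0 ≤ 2 * |t|)
      rw [hc₂]
      nlinarith [sq_nonneg |μ|]
    have v7 : 0 ≤ c₁ * (1 + |μ| ^ 2) := by positivity
    linarith

/-- The defect of the limiting profile in the asymptotic region `y → -∞`. -/
noncomputable def profileDefect (χ : ℝ → ℝ → ℂ) (τ lam₀ t Y μ : ℝ) : ℂ :=
  χ ((τ + lam₀ * -Y) - μ * -Y - μ ^ 2 * t) μ - χ ((τ - lam₀ ^ 2 * t - Y * lam₀) + Y * μ) lam₀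

theorem continuous_profileDefect (hs : SolvabilityConditions χ) (τ lam₀ t Y : ℝ) :
    Continuous (profileDefect χ τ lam₀ t Y) :=
  (hs.continuous.comp (f := fun μ : ℝ => ((τ + lam₀ * -Y) - μ * -Y - μ ^ 2 * t, μ))
    (by fun_prop)).sub
  (hs.continuous.comp (f := fun μ : ℝ => ((τ - lam₀ ^ 2 * t - Y * lam₀) + Y * μ, lam₀))
    (by fun_prop))

theorem tendsto_integral_profileDefect (hs : SolvabilityConditions χ) (hj : JostConditions χ)
    (τ lam₀ t : ℝ) :
    Tendsto (fun Y => ∫ s, ‖profileDefect χ τ lam₀ t Y (lam₀ + s / Y)‖ ^ 2) atTop (𝓝 0) := by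
  obtain ⟨C, hC, hbd⟩ := hj.global_bounds
  obtain ⟨c, hc⟩ := exists_norm_phase_le hj τ lam₀ t
  set τ' := τ - lam₀ ^ 2 * t with hτ'
  set K := c + C * (1 + |τ'|) with hK
  have h0 : (0 : ℝ) = ∫ s : ℝ, (0 : ℝ) := by simp
  rw [h0]
  refine tendsto_integral_filter_of_dominated_convergence (fun s => (K / (1 + |s|)) ^ 2) ?_ ?_
    (memLp_one_div_one_add_abs K).integrable_sq (ae_of_all _ fun s => ?_)
  · exact Eventually.of_forall fun Y => (((continuous_profileDefect hs τ lam₀ t Y).comp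
      (by fun_prop)).norm.pow 2).aestronglyMeasurable
  · filter_upwards [eventually_ge_atTop 1] with Y hY
    refine ae_of_all _ fun s => ?_
    rw [norm_pow, norm_norm]
    gcongr
    have hY0 : Y ≠ 0 := by linarith
    have h1 := hc Y (lam₀ + s / Y) hY
    rw [add_sub_cancel_left, mul_div_cancel₀ _ hY0] at h1
    have h2 : ‖χ ((τ' - Y * lam₀) + Y * (lam₀ + s / Y)) lam₀‖ ≤ C * (1 + |τ'|) / (1 + |s|) := by
      have e : (τ' - Y * lam₀) + Y * (lam₀ + s / Y) = τ' + s := by field_simp; ring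
      rw [e]
      refine (hbd _ _).2.1.trans ?_
      rw [div_le_div_iff₀ (by positivity) (by positivity), mul_assoc]
      refine mul_le_mul_of_nonneg_left ?_ hC.le
      have := abs_sub (τ' + s) τ'
      rw [add_sub_cancel_left] at this
      nlinarith [mul_nonneg (abs_nonneg τ') (abs_nonneg (τ' + s))]
    refine (norm_sub_le _ _).trans ((add_le_add h1 h2).trans_eq ?_)
    rw [hK]; ring
  · have hsY : Tendsto (fun Y : ℝ => s / Y) atTop (𝓝 0) := tendsto_const_nhds.div_atTop tendsto_id
    have hlim : Tendsto (fun Y : ℝ => χ (τ' + s - s / Y * (t * (2 * lam₀ + s / Y))) (lam₀ + s / Y)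
        - χ (τ' + s) lam₀) atTop (𝓝 0) := by
      have hcont : Continuous fun z : ℝ =>
          χ (τ' + s - z * (t * (2 * lam₀ + z))) (lam₀ + z) - χ (τ' + s) lam₀ :=
        (hs.continuous.comp (f := fun z : ℝ => (τ' + s - z * (t * (2 * lam₀ + z)), lam₀ + z))
          (by fun_prop)).sub continuous_const
      have := (hcont.tendsto 0).comp hsY
      simpa [Function.comp_def] using this
    have h2 := (hlim.norm.pow 2)
    rw [norm_zero, zero_pow two_ne_zero] at h2
    refine h2.congr' ?_
    filter_upwards [eventually_gt_atTop 0] with Y hY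
    rw [profileDefect]
    congr 4
    · rw [phase_eq]; field_simp; ring
    · field_simp; ring

/-- The substitution `μ = λ₀ + s/Y` produces the factor `1/Y`. As the rescaled integral tends to 0,
the defect is `o(Y^(-1/2))` in L². -/
theorem eLpNorm_profileDefect (hs : SolvabilityConditions χ) (hj : JostConditions χ)
    (τ lam₀ t : ℝ) {Y : ℝ} (hY : 0 < Y) :
    eLpNorm (profileDefect χ τ lam₀ t Y) 2 volume
      = ENNReal.ofReal (√((∫ s, ‖profileDefect χ τ lam₀ t Y (lam₀ + s / Y)‖ ^ 2) / Y)) := by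
  have hL : MemLp (profileDefect χ τ lam₀ t Y) 2 volume :=
    (memLp_data hs (Continuous.aestronglyMeasurable (by fun_prop))).sub
      (isRieszSum_zero_of_boundaryValue hs hj lam₀ (τ - lam₀ ^ 2 * t - Y * lam₀) hY).1
  have h1 := Measure.integral_comp_div
    (fun u => ‖profileDefect χ τ lam₀ t Y (lam₀ + u)‖ ^ 2) Y
  rw [integral_add_left_eq_self (fun u => ‖profileDefect χ τ lam₀ t Y u‖ ^ 2), smul_eq_mul,
    abs_of_pos hY] at h1
  rw [h1, mul_div_cancel_left₀ _ hY.ne', ← eLpNorm_norm, eLpNorm_two_eq_sqrt hL.norm]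

/-- The solution is compared with the zero function, which satisfies the relation exactly for the
profile data. The part of the error due to `ω` itself carries 1/4 and is absorbed. -/
theorem eLpNorm_le_profileDefect (hs : SolvabilityConditions χ) (hj : JostConditions χ)
    {τ lam₀ t Y : ℝ} (hY : 0 < Y) {ω : ℝ → ℝ}
    (hω : IsInverseSolution χ (τ + lam₀ * -Y) (-Y) t ω) :
    eLpNorm ω 2 volume ≤ 12 * eLpNorm (profileDefect χ τ lam₀ t Y) 2 volume := by
  rw [isInverseSolution_iff] at hω
  obtain ⟨hL, hsum⟩ := isRieszSum_zero_of_boundaryValue hs hj lam₀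
    (τ - lam₀ ^ 2 * t - Y * lam₀) hY
  have hωm := hω.1.aestronglyMeasurable
  have hre : ∀ l, |reData χ (τ + lam₀ * -Y) (-Y) t ω l
      - (χ ((τ - lam₀ ^ 2 * t - Y * lam₀) + Y * l) lam₀).re|
      ≤ 1 / 4 * |ω l| + ‖profileDefect χ τ lam₀ t Y l‖ := fun l => by
    have h1 := abs_re_sub_le hs (psi (τ + lam₀ * -Y) (-Y) t ω l)
      ((τ + lam₀ * -Y) - l * -Y - l ^ 2 * t) l
    have h2 := Complex.abs_re_le_norm (profileDefect χ τ lam₀ t Y l)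
    rw [psi_add, add_sub_cancel_left] at h1
    simp only [profileDefect, Complex.sub_re] at h2
    refine le_trans ?_ (add_le_add h1 h2)
    refine le_trans (le_of_eq ?_) (abs_add_le _ _)
    simp only [reData, psi_add]
    congr 1; ring
  have him : ∀ l, |imData χ (τ + lam₀ * -Y) (-Y) t ω l
      - (χ ((τ - lam₀ ^ 2 * t - Y * lam₀) + Y * l) lam₀).im|
      ≤ 1 / 4 * |ω l| + ‖profileDefect χ τ lam₀ t Y l‖ := fun l => by
    have h1 := abs_im_sub_le hs (psi (τ + lam₀ * -Y) (-Y) t ω l)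
      ((τ + lam₀ * -Y) - l * -Y - l ^ 2 * t) l
    have h2 := Complex.abs_im_le_norm (profileDefect χ τ lam₀ t Y l)
    rw [psi_add, add_sub_cancel_left] at h1
    simp only [profileDefect, Complex.sub_im] at h2
    refine le_trans ?_ (add_le_add h1 h2)
    refine le_trans (le_of_eq ?_) (abs_add_le _ _)
    simp only [imData, psi_add]
    congr 1; ring
  have h := (hω.2.eLpNorm_sub_le hsum (memLp_reData hs hωm) hL.re (memLp_imData hs hωm) hL.im
    (ae_of_all _ hre) (ae_of_all _ him)).2
  simp only [sub_zero] at h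
  refine le_twelve_mul_of_le_three_mul hω.1.2.ne (h.trans ?_)
  gcongr
  have e : (fun l => 1 / 4 * |ω l| + ‖profileDefect χ τ lam₀ t Y l‖)
      = ((1 / 4 : ℝ) • fun l => ‖ω l‖) + fun l => ‖profileDefect χ τ lam₀ t Y l‖ := by
    ext l; simp
  rw [e]
  refine (eLpNorm_add_le (hωm.norm.const_smul _)
    (continuous_profileDefect hs τ lam₀ t Y).norm.aestronglyMeasurable (by norm_num)).trans ?_
  rw [eLpNorm_const_smul, eLpNorm_norm, eLpNorm_norm, Real.enorm_of_nonneg (by norm_num)]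

/-- A qualitative bound, with no uniformity in `Y`: finiteness of `sup|ω|` is needed before it can
be bootstrapped. -/
theorem bddAbove_range_abs_of_isInverseSolution (hs : SolvabilityConditions χ)
    (hj : JostConditions χ) {x y t : ℝ} {ω : ℝ → ℝ} (hω : IsInverseSolution χ x y t ω)
    (hc : Continuous ω) : BddAbove (Set.range fun l => |ω l|) := by
  obtain ⟨c, hc0, hb⟩ := exists_norm_curveDeriv_le hj x y t
  have hB := (ENNReal.ofReal_toReal (memLp_one_div_one_add_abs c).2.ne).ge
  have hL := isL2Lipschitz_of_isInverseSolution hs hj hω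
    (continuous_const.div (by fun_prop) fun μ => by positivity) (fun l => hb (ω l)) hB
  refine ⟨_, Set.forall_mem_range.2 fun l => abs_le_of_isL2Lipschitz hω.1 hc (by positivity) hL
    ENNReal.toReal_nonneg (ENNReal.ofReal_toReal hω.1.2.ne).ge one_pos l⟩

theorem exists_isL2Lipschitz_le_sqrt (hs : SolvabilityConditions χ) (hj : JostConditions χ)
    (τ lam₀ t : ℝ) : ∃ c, 0 ≤ c ∧ ∀ (Y W : ℝ) (ω : ℝ → ℝ), 1 ≤ Y →
      IsInverseSolution χ (τ + lam₀ * -Y) (-Y) t ω → (∀ l, |ω l| ≤ W) →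
      IsL2Lipschitz (c * (1 + W ^ 2) * √Y) ω := by
  obtain ⟨c, hc0, hb⟩ := exists_norm_curveDeriv_le_poissonKernel hj τ lam₀ t
  set N := (eLpNorm (fun μ : ℝ => 1 / (1 + |μ|)) 2 volume).toReal with hN
  have hN0 : 0 ≤ N := ENNReal.toReal_nonneg
  refine ⟨12 * (c * (√Real.pi + N)), by positivity, fun Y W ω hY hω hW => ?_⟩
  have hY0 : 0 < Y := by linarith
  set b : ℝ → ℝ := fun μ =>
    c * (1 + W ^ 2) * (poissonKernel (1 / Y) (μ - lam₀) + 1 / (1 + |μ|)) with hbdef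
  have hPc := continuous_poissonKernel (one_div_pos.2 hY0)
  have hQc : Continuous fun μ : ℝ => 1 / (1 + |μ|) :=
    continuous_const.div (by fun_prop) fun μ => by positivity
  have hbc : Continuous b := continuous_const.mul ((hPc.comp (by fun_prop)).add hQc)
  have hB : eLpNorm b 2 volume ≤ ENNReal.ofReal (c * (1 + W ^ 2) * ((√Real.pi + N) * √Y)) := by
    have e : b = (c * (1 + W ^ 2)) •
        ((fun μ => poissonKernel (1 / Y) (μ - lam₀)) + fun μ : ℝ => 1 / (1 + |μ|)) := rfl
    rw [e, eLpNorm_const_smul, Real.enorm_of_nonneg (by positivity),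
      ENNReal.ofReal_mul (p := c * (1 + W ^ 2)) (by positivity)]
    refine mul_le_mul' le_rfl ?_
    refine (eLpNorm_add_le (hPc.comp (by fun_prop)).aestronglyMeasurable
      hQc.aestronglyMeasurable (by norm_num)).trans ?_
    have e1 : eLpNorm (fun μ => poissonKernel (1 / Y) (μ - lam₀)) 2 volume
        ≤ ENNReal.ofReal (√Real.pi * √Y) := by
      have := eLpNorm_comp_measurePreserving (p := 2) hPc.aestronglyMeasurable
        (measurePreserving_sub_right volume lam₀)
      refine this.trans_le ((eLpNorm_poissonKernel_le (one_div_pos.2 hY0)).trans_eq ?_)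
      rw [← Real.sqrt_mul Real.pi_pos.le]; simp
    have e2 : eLpNorm (fun μ : ℝ => 1 / (1 + |μ|)) 2 volume ≤ ENNReal.ofReal (N * √Y) := by
      rw [← ENNReal.ofReal_toReal (memLp_one_div_one_add_abs 1).2.ne]
      refine ENNReal.ofReal_le_ofReal (le_mul_of_one_le_right hN0 ?_)
      exact Real.one_le_sqrt.2 hY
    rw [add_mul, ENNReal.ofReal_add (by positivity) (by positivity)]
    exact add_le_add e1 e2
  have h := isL2Lipschitz_of_isInverseSolution hs hj hω hbc (fun l μ => hb Y W (ω l) μ hY (hW l)) hB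
  have e : 12 * (c * (1 + W ^ 2) * ((√Real.pi + N) * √Y))
      = 12 * (c * (√Real.pi + N)) * (1 + W ^ 2) * √Y := by ring
  rwa [e] at h

/-- A bootstrap: the Lipschitz constant depends on `W = sup|ω|`, but only through `1 + W²`, and a
scale adapted to `W` makes the resulting bound on `W` linear in `W`. -/
theorem exists_abs_le_sqrt_mul (hs : SolvabilityConditions χ) (hj : JostConditions χ)
    (τ lam₀ t : ℝ) : ∃ K, 0 ≤ K ∧ ∀ (Y η : ℝ) (ω : ℝ → ℝ), 1 ≤ Y → 0 < η →
      √(∫ s, ‖profileDefect χ τ lam₀ t Y (lam₀ + s / Y)‖ ^ 2) ≤ η → K * √η ≤ 1 / 2 →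
      IsInverseSolution χ (τ + lam₀ * -Y) (-Y) t ω → Continuous ω →
      ∀ l, |ω l| ≤ 2 * (K * √η) := by
  obtain ⟨c, hc0, hLip⟩ := exists_isL2Lipschitz_le_sqrt hs hj τ lam₀ t
  refine ⟨12 + 2 * c, by positivity, fun Y η ω hY hη hD hsmall hω hωc l => ?_⟩
  have hY0 : 0 < Y := by linarith
  set D := ∫ s, ‖profileDefect χ τ lam₀ t Y (lam₀ + s / Y)‖ ^ 2 with hDdef
  have hbdd := bddAbove_range_abs_of_isInverseSolution hs hj hω hωc
  set W := ⨆ l, |ω l| with hWdef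
  have hW : ∀ l, |ω l| ≤ W := fun l => le_ciSup hbdd l
  have hW0 : 0 ≤ W := (abs_nonneg _).trans (hW 0)
  have hL := hLip Y W ω hY hω hW
  have hn : eLpNorm ω 2 volume ≤ ENNReal.ofReal (12 * √(D / Y)) := by
    refine (eLpNorm_le_profileDefect hs hj hY0 hω).trans_eq ?_
    rw [eLpNorm_profileDefect hs hj τ lam₀ t hY0, ENNReal.ofReal_mul (by norm_num), ← hDdef]
    norm_num
  have hw1 : 0 < 1 + W ^ 2 := by positivity
  have hsw : √(1 + W ^ 2) ≤ 1 + W := by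
    rw [Real.sqrt_le_left (by positivity)]; nlinarith
  have hsw0 := Real.sqrt_pos.2 hw1
  have hsY := Real.sqrt_pos.2 hY0
  have hsη := Real.sqrt_pos.2 hη
  have hle : ∀ l, |ω l| ≤ (12 + 2 * c) * √η * (1 + W) := fun l => by
    -- The scale `r = η/(Y(1 + W²))` balances the two terms: both become multiples of `√η · √(1 +
    -- W²)`, with all powers of `Y` cancelled.
    have h := abs_le_of_isL2Lipschitz hω.1 hωc (by positivity) hL (by positivity) hn
      (r := η / (Y * (1 + W ^ 2))) (by positivity) l
    refine h.trans ?_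
    rw [Real.sqrt_div hη.le, Real.sqrt_mul hY0.le, Real.sqrt_div' _ hY0.le]
    have t1 : 12 * (√D / √Y) / (√η / (√Y * √(1 + W ^ 2))) ≤ 12 * √η * (1 + W) := by
      have : 12 * (√D / √Y) / (√η / (√Y * √(1 + W ^ 2))) = 12 * (√D / √η) * √(1 + W ^ 2) := by
        field_simp
      rw [this]
      gcongr
      rw [div_le_iff₀ hsη, Real.mul_self_sqrt hη.le]
      exact hD
    have t2 : 2 * (c * (1 + W ^ 2) * √Y) * (√η / (√Y * √(1 + W ^ 2))) ≤ 2 * c * √η * (1 + W) := by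
      have : 2 * (c * (1 + W ^ 2) * √Y) * (√η / (√Y * √(1 + W ^ 2)))
          = 2 * c * √η * ((1 + W ^ 2) / √(1 + W ^ 2)) := by
        field_simp
      rw [this, Real.div_sqrt]
      gcongr
    linarith
  -- From `W ≤ K√η(1 + W)` and `K√η ≤ 1/2` follows first `W ≤ 1`, then `W ≤ 2K√η`.
  have hWle : W ≤ (12 + 2 * c) * √η * (1 + W) := ciSup_le hle
  have := hW l
  nlinarith

theorem tendsto_zero_of_isInverseSolution (hs : SolvabilityConditions χ) (hj : JostConditions χ)
    (τ lam₀ t : ℝ) {ω : ℝ → ℝ → ℝ} (hω : ∀ Y, IsInverseSolution χ (τ + lam₀ * -Y) (-Y) t (ω Y))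
    (hωc : ∀ Y, Continuous (ω Y)) (l : ℝ) : Tendsto (fun Y => ω Y l) atTop (𝓝 0) := by
  obtain ⟨K, hK0, hK⟩ := exists_abs_le_sqrt_mul hs hj τ lam₀ t
  -- The summand `1/Y` keeps `η` strictly positive even if the defect vanishes.
  set η : ℝ → ℝ := fun Y =>
    √(∫ s, ‖profileDefect χ τ lam₀ t Y (lam₀ + s / Y)‖ ^ 2) + 1 / Y with hη
  have hη0 : Tendsto η atTop (𝓝 0) := by
    have h1 := (tendsto_integral_profileDefect hs hj τ lam₀ t).sqrt
    have h2 : Tendsto (fun Y : ℝ => 1 / Y) atTop (𝓝 0) := tendsto_const_nhds.div_atTop tendsto_id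
    simpa [hη] using h1.add h2
  have hKη : Tendsto (fun Y => K * √(η Y)) atTop (𝓝 0) := by simpa using hη0.sqrt.const_mul K
  refine squeeze_zero_norm' ?_ (by simpa using hKη.const_mul 2)
  filter_upwards [eventually_ge_atTop 1, hKη.eventually_le_const (by norm_num : (0 : ℝ) < 1 / 2)]
    with Y hY hsmall
  have hY1 : 0 < 1 / Y := by positivity
  exact hK Y (η Y) (ω Y) hY (add_pos_of_nonneg_of_pos (Real.sqrt_nonneg _) hY1)
    (le_add_of_nonneg_right hY1.le) hsmall (hω Y) (hωc Y) l

end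

end PavlovIST

theorem theoremT (χ : ℝ → ℝ → ℂ)
    (hsolv : PavlovIST.SolvabilityConditions χ) (hjost : PavlovIST.JostConditions χ) :
    ∃ ω : ℝ → ℝ → ℝ → ℝ → ℝ,
      (∀ x y t : ℝ, 0 ≤ t →
        PavlovIST.IsInverseSolution χ x y t (ω x y t) ∧
        Continuous (ω x y t) ∧
        ∀ ω' : ℝ → ℝ, PavlovIST.IsInverseSolution χ x y t ω' → ω' =ᵐ[volume] ω x y t) ∧
      ∀ τ t lam₀ : ℝ, 0 ≤ t →
        Tendsto (fun y : ℝ => ω (τ + lam₀ * y) y t lam₀) atBot (𝓝 0) := by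
  choose ω hω hωc using PavlovIST.exists_isInverseSolution hsolv hjost
  refine ⟨ω, fun x y t _ => ⟨hω x y t, hωc x y t, fun ω' h' =>
    PavlovIST.ae_eq_of_isInverseSolution hsolv h' (hω x y t)⟩, fun τ t lam₀ _ => ?_⟩
  have h := (PavlovIST.tendsto_zero_of_isInverseSolution hsolv hjost τ lam₀ t
    (ω := fun Y => ω (τ + lam₀ * -Y) (-Y) t) (fun Y => hω _ _ _) (fun Y => hωc _ _ _)
    lam₀).comp tendsto_neg_atBot_atTop
  simpa [Function.comp_def] using h
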